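/- Let $\mathbf{dJo}$ be the de Jonquières group, i.e. the group of birational transformations of $\mathbb{C}^2$ of the form $$(x,y)\dashrightarrow\Big(\frac{ax+b}{cx+d},\frac{\alpha(x)y+\beta(x)}{\gamma(x)y+\delta(x)}\Big),$$ where $a,b,c,d\in\mathbb{C}$, $\alpha,\beta,\gamma,\delta\in\mathbb{C}(x)$, $ad-bc\neq0$ and $\alpha\delta-\beta\gamma\neq0$. It preserves the fibration $(x,y)\mapsto x$, hence acts on its base through the first coordinate. An element of $\mathbf{dJo}$ is called diagonalisable if it is conjugate in $\mathbf{dJo}$ to some $(x,y)\mapsto(\lambda x,\mu y)$ with $\lambda,\mu\in\mathbb{C}^*$. Let $n\geq1$. For $i=1,2$, let $h_i\in\mathbf{dJo}$ be a non-diagonalisable element of finite order $2n$, whose action on the base of the fibration has order $n$ (so that $(h_i)^n$ is an involution acting trivially on the base), and such that $(h_i)^n$ fixes pointwise a (possibly reducible) algebraic curve $\Gamma_i\subset\mathbb{C}^2$ for which the projection on the first factor induces a $(2:1)$-map $\pi_i:\Gamma_i\to\mathbb{C}$ (that is, a general fibre of $\pi_i$ consists of two points). Then the following conditions are equivalent: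 1. The elements $h_1$ and $h_2$ are conjugate in $\mathbf{dJo}$. 2. There exist two birational maps $\psi:\Gamma_1\dashrightarrow\Gamma_2$ and $\alpha:\mathbb{C}\dashrightarrow\mathbb{C}$ such that $\pi_2\psi=\alpha\pi_1$ and $\psi$ conjugates the restriction of $h_1$ to $\Gamma_1$ to the restriction of $h_2$ to $\Gamma_2$. -/

import Mathlib

open scoped Polynomial.Bivariate IntermediateField

noncomputable section

namespace DeJonquieres

/-- The field `ℂ(x, y)` of rational functions on the plane `ℂ²`. -/
abbrev FunctionField : Type := FractionRing ℂ[X][Y]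

/-- The first coordinate function of the plane. -/
def x : FunctionField := algebraMap ℂ[X][Y] FunctionField (Polynomial.C Polynomial.X)

/-- The second coordinate function of the plane. -/
def y : FunctionField := algebraMap ℂ[X][Y] FunctionField Y

/-- The group `Bir(ℂ²)` of birational transformations of the plane. A birational transformation
`g` is given by its comorphism `f ↦ f ∘ g`, an automorphism of `ℂ(x, y)` over `ℂ`; the opposite
group is taken so that multiplication is composition of transformations. -/
abbrev Bir : Type := (FunctionField ≃ₐ[ℂ] FunctionField)ᵐᵒᵖ

/-- The pull-back `f ∘ g` of a rational function `f` by a birational transformation `g`. -/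
def pullback (g : Bir) (f : FunctionField) : FunctionField := g.unop f

/-- `s = (a t + b) / (c t + d)` for some `a, b, c, d` in the field `L` with `a d - b c ≠ 0`. -/
def IsMoebius (L : IntermediateField ℂ FunctionField) (t s : FunctionField) : Prop :=
  ∃ a ∈ L, ∃ b ∈ L, ∃ c ∈ L, ∃ d ∈ L, a * d - b * c ≠ 0 ∧ s = (a * t + b) / (c * t + d)

theorem x_notMem_bot : x ∉ (⊥ : IntermediateField ℂ FunctionField) := by
  rw [IntermediateField.mem_bot]
  rintro ⟨c, hc⟩
  rw [IsScalarTower.algebraMap_apply ℂ ℂ[X][Y] FunctionField] at hc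
  have h := IsFractionRing.injective ℂ[X][Y] FunctionField hc
  rw [Polynomial.algebraMap_apply, Polynomial.algebraMap_apply] at h
  have h2 := Polynomial.C_injective h
  have h3 := congrArg Polynomial.natDegree h2
  simp at h3

theorem y_notMem_adjoin_x : y ∉ ℂ⟮x⟯ := by
  intro h
  rw [IntermediateField.mem_adjoin_simple_iff] at h
  obtain ⟨p, q, hpq⟩ := h
  have hx : ∀ r : Polynomial ℂ, Polynomial.aeval x r =
      algebraMap ℂ[X][Y] FunctionField (Polynomial.C r) := by
    intro r
    have : (Polynomial.aeval x : Polynomial ℂ →ₐ[ℂ] FunctionField) =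
        (IsScalarTower.toAlgHom ℂ ℂ[X][Y] FunctionField).comp
          (IsScalarTower.toAlgHom ℂ (Polynomial ℂ) ℂ[X][Y]) := by
      ext
      simp [x]
    rw [this]
    rfl
  rw [hx, hx] at hpq
  have inj := IsFractionRing.injective ℂ[X][Y] FunctionField
  by_cases hq : q = 0
  · rw [hq] at hpq
    simp only [map_zero, div_zero] at hpq
    exact Polynomial.X_ne_zero (inj (hpq.trans (map_zero _).symm))
  · have hq' : algebraMap ℂ[X][Y] FunctionField (Polynomial.C q) ≠ 0 := by
      intro h0
      have h1 := inj (h0.trans (map_zero _).symm)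
      rw [← Polynomial.C_0] at h1
      exact hq (Polynomial.C_injective h1)
    rw [eq_div_iff hq', y, ← map_mul] at hpq
    have h1 := congrArg Polynomial.natDegree (inj hpq)
    rw [mul_comm, Polynomial.natDegree_C_mul_X q hq, Polynomial.natDegree_C] at h1
    exact one_ne_zero h1

theorem moebius_denom_ne_zero {L : IntermediateField ℂ FunctionField} {t : FunctionField}
    (ht : t ∉ L) {a b c d : FunctionField} (hc : c ∈ L) (hd : d ∈ L)
    (h : a * d - b * c ≠ 0) : c * t + d ≠ 0 := by
  intro h0
  by_cases hc0 : c = 0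
  · subst hc0
    simp only [zero_mul, zero_add] at h0
    simp [h0] at h
  · apply ht
    have : t = -d / c := by
      rw [eq_div_iff hc0]
      linear_combination h0
    rw [this]
    exact div_mem (neg_mem hd) hc

theorem IsMoebius.refl (L : IntermediateField ℂ FunctionField) (t : FunctionField) :
    IsMoebius L t t :=
  ⟨1, one_mem _, 0, zero_mem _, 0, zero_mem _, 1, one_mem _, by simp, by simp⟩

theorem IsMoebius.symm {L : IntermediateField ℂ FunctionField} {t s : FunctionField}
    (ht : t ∉ L) (h : IsMoebius L t s) : IsMoebius L s t := by
  obtain ⟨a, ha, b, hb, c, hc, d, hd, hne, hs⟩ := h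
  have h0 := moebius_denom_ne_zero ht hc hd hne
  refine ⟨d, hd, -b, neg_mem hb, -c, neg_mem hc, a, ha, ?_, ?_⟩
  · intro h1
    exact hne (by linear_combination h1)
  · have h1 : -c * s + a ≠ 0 := by
      rw [hs]
      intro h2
      field_simp at h2
      exact hne (by linear_combination h2)
    have hs2 : s * (c * t + d) = a * t + b := by
      rw [hs, div_mul_cancel₀ _ h0]
    rw [eq_div_iff h1]
    linear_combination -hs2

theorem IsMoebius.notMem {L : IntermediateField ℂ FunctionField} {t s : FunctionField}
    (ht : t ∉ L) (h : IsMoebius L t s) : s ∉ L := by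
  obtain ⟨a, ha, b, hb, c, hc, d, hd, _, hs⟩ := h.symm ht
  intro hsL
  apply ht
  rw [hs]
  exact div_mem (add_mem (mul_mem ha hsL) hb) (add_mem (mul_mem hc hsL) hd)

theorem IsMoebius.trans {L : IntermediateField ℂ FunctionField} {t s u : FunctionField}
    (ht : t ∉ L) (h : IsMoebius L t s) (h' : IsMoebius L s u) : IsMoebius L t u := by
  have hs' := h.notMem ht
  obtain ⟨a, ha, b, hb, c, hc, d, hd, hne, hs⟩ := h
  obtain ⟨a', ha', b', hb', c', hc', d', hd', hne', hu⟩ := h'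
  have h0 := moebius_denom_ne_zero ht hc hd hne
  have h1 := moebius_denom_ne_zero hs' hc' hd' hne'
  have hdet : (a' * a + b' * c) * (c' * b + d' * d) - (a' * b + b' * d) * (c' * a + d' * c) ≠ 0 := by
    intro h2
    exact mul_ne_zero hne' hne (by linear_combination h2)
  have mC : c' * a + d' * c ∈ L := add_mem (mul_mem hc' ha) (mul_mem hd' hc)
  have mD : c' * b + d' * d ∈ L := add_mem (mul_mem hc' hb) (mul_mem hd' hd)
  have h3 := moebius_denom_ne_zero ht mC mD hdet
  refine ⟨a' * a + b' * c, add_mem (mul_mem ha' ha) (mul_mem hb' hc),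
    a' * b + b' * d, add_mem (mul_mem ha' hb) (mul_mem hb' hd), _, mC, _, mD, hdet, ?_⟩
  have hs2 : s * (c * t + d) = a * t + b := by
    rw [hs, div_mul_cancel₀ _ h0]
  rw [hu, div_eq_div_iff h1 h3]
  linear_combination (a' * d' - b' * c') * hs2

theorem IsMoebius.map {L : IntermediateField ℂ FunctionField} {t s : FunctionField}
    (φ : FunctionField ≃ₐ[ℂ] FunctionField) (hφ : ∀ z ∈ L, φ z ∈ L) (h : IsMoebius L t s) :
    IsMoebius L (φ t) (φ s) := by
  obtain ⟨a, ha, b, hb, c, hc, d, hd, hne, hs⟩ := h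
  refine ⟨φ a, hφ a ha, φ b, hφ b hb, φ c, hφ c hc, φ d, hφ d hd, ?_, ?_⟩
  · rw [← map_mul, ← map_mul, ← map_sub]
    exact fun h0 => hne ((map_eq_zero φ).1 h0)
  · rw [hs, map_div₀, map_add, map_add, map_mul, map_mul]

theorem map_mem_bot (φ : FunctionField ≃ₐ[ℂ] FunctionField) (z : FunctionField)
    (hz : z ∈ (⊥ : IntermediateField ℂ FunctionField)) :
    φ z ∈ (⊥ : IntermediateField ℂ FunctionField) := by
  rw [IntermediateField.mem_bot] at hz ⊢
  obtain ⟨c, rfl⟩ := hz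
  exact ⟨c, (φ.commutes c).symm⟩

theorem map_mem_adjoin_x (φ : FunctionField ≃ₐ[ℂ] FunctionField) (h : IsMoebius ⊥ x (φ x))
    (z : FunctionField) (hz : z ∈ ℂ⟮x⟯) : φ z ∈ ℂ⟮x⟯ := by
  have hx : φ x ∈ ℂ⟮x⟯ := by
    obtain ⟨a, ha, b, hb, c, hc, d, hd, _, hs⟩ := h
    have hle : (⊥ : IntermediateField ℂ FunctionField) ≤ ℂ⟮x⟯ := bot_le
    have hxx := IntermediateField.mem_adjoin_simple_self ℂ x
    rw [hs]
    exact div_mem (add_mem (mul_mem (hle ha) hxx) (hle hb))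
      (add_mem (mul_mem (hle hc) hxx) (hle hd))
  have : ℂ⟮x⟯ ≤ (ℂ⟮x⟯).comap (φ : FunctionField →ₐ[ℂ] FunctionField) := by
    rw [IntermediateField.adjoin_simple_le_iff]
    exact hx
  exact this hz

/-- The de Jonquières group: the birational transformations of the plane of the form
`(x, y) ⇢ ((a x + b) / (c x + d), (α(x) y + β(x)) / (γ(x) y + δ(x)))` with `a, b, c, d ∈ ℂ`,
`α, β, γ, δ ∈ ℂ(x)`, `a d - b c ≠ 0` and `α δ - β γ ≠ 0`. -/
def dJo : Subgroup Bir where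
  carrier := {g | IsMoebius ⊥ x (pullback g x) ∧ IsMoebius ℂ⟮x⟯ y (pullback g y)}
  one_mem' := ⟨IsMoebius.refl _ _, IsMoebius.refl _ _⟩
  mul_mem' := by
    rintro g h ⟨hgx, hgy⟩ ⟨hhx, hhy⟩
    exact ⟨hhx.trans x_notMem_bot (hgx.map h.unop (map_mem_bot _)),
      hhy.trans y_notMem_adjoin_x (hgy.map h.unop (map_mem_adjoin_x _ hhx))⟩
  inv_mem' := by
    rintro g ⟨hgx, hgy⟩
    have hx : IsMoebius ⊥ x (pullback g⁻¹ x) := by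
      have h := (hgx.symm x_notMem_bot).map g.unop.symm (map_mem_bot _)
      rwa [pullback, AlgEquiv.symm_apply_apply] at h
    refine ⟨hx, ?_⟩
    have h := (hgy.symm y_notMem_adjoin_x).map g.unop.symm (map_mem_adjoin_x g.unop.symm hx)
    rwa [pullback, AlgEquiv.symm_apply_apply] at h

/-- The action of `g` on the base of the fibration `(x, y) ↦ x` has (finite) order `n`. The power
`g ^ m` acts trivially on the base exactly when its first coordinate is `x`. -/
def HasBaseOrder (g : dJo) (n : ℕ) : Prop :=
  0 < n ∧ ∀ m : ℕ, pullback (g ^ m : dJo) x = x ↔ n ∣ m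

/-- `g` is conjugate in `dJo` to a diagonal transformation `(x, y) ⇢ (a x, b y)`, where
`a, b ∈ ℂ` are non-zero. -/
def IsDiagonalisable (g : dJo) : Prop :=
  ∃ d : dJo, IsConj g d ∧ ∃ a b : ℂ, a ≠ 0 ∧ b ≠ 0 ∧ pullback d x = a • x ∧ pullback d y = b • y

/-- The fraction `f` of elements of the polynomial ring `A` is regular, with value `v`, at the
point of affine space whose evaluation homomorphism is `ev`. -/
def HasValue {A : Type*} [CommRing A] (ev : A →+* ℂ) (f : FractionRing A) (v : ℂ) : Prop :=
  ∃ a b : A, ev b ≠ 0 ∧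
    f * algebraMap A (FractionRing A) b = algebraMap A (FractionRing A) a ∧ v = ev a / ev b

/-- A rational map from the line `ℂ` to itself, given by a rational function `α ∈ ℂ(x)`. -/
abbrev LineMap : Type := FractionRing (Polynomial ℂ)

/-- The rational map `α` is defined at `s` and sends `s` to `t`. -/
def LineMap.Sends (α : LineMap) (s t : ℂ) : Prop := HasValue (Polynomial.evalRingHom s) α t

/-- A rational map to the plane `ℂ²`, given by its two coordinate functions in `ℂ(x, y)`. -/
abbrev PlaneMap : Type := FunctionField × FunctionField

/-- The rational map `ψ` is defined at `p` and sends `p` to `q`. -/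
def PlaneMap.Sends (ψ : PlaneMap) (p q : ℂ × ℂ) : Prop :=
  HasValue (Polynomial.evalEvalRingHom p.1 p.2) ψ.1 q.1 ∧
    HasValue (Polynomial.evalEvalRingHom p.1 p.2) ψ.2 q.2

/-- The coordinates of an element of `dJo`, as a rational map from the plane to itself. -/
def toPlaneMap (g : dJo) : PlaneMap := (pullback g x, pullback g y)

/-- `P` holds at all but finitely many points of `S`; for a curve `S` this means that it holds on a
dense Zariski open subset. -/
def Generically {T : Type*} (S : Set T) (P : T → Prop) : Prop := {p ∈ S | ¬ P p}.Finite

/-- A (possibly reducible) algebraic curve in the plane: the zero set of a non-constant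
polynomial. -/
def IsCurve (Γ : Set (ℂ × ℂ)) : Prop :=
  ∃ f : ℂ[X][Y], f ≠ 0 ∧ ¬ IsUnit f ∧ Γ = {p | f.evalEval p.1 p.2 = 0}

/-- The projection `Γ → ℂ`, `(x, y) ↦ x`, is a `(2 : 1)`-map: a general fibre has two points. -/
def IsTwoToOne (Γ : Set (ℂ × ℂ)) : Prop :=
  Generically Set.univ fun s : ℂ => {p ∈ Γ | p.1 = s}.ncard = 2

/-- `g` fixes the curve `Γ` (pointwise, as a rational map). -/
def FixesCurve (g : dJo) (Γ : Set (ℂ × ℂ)) : Prop :=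
  Generically Γ fun p => (toPlaneMap g).Sends p p

/-- `ψ` restricts to a birational map `Γ₁ ⇢ Γ₂`, for curves `Γ₁`, `Γ₂` in the plane: there is a
rational map in the other direction such that both composites are defined and equal to the
identity on dense open subsets. -/
def PlaneMap.IsBirational (ψ : PlaneMap) (Γ₁ Γ₂ : Set (ℂ × ℂ)) : Prop :=
  ∃ φ : PlaneMap,
    Generically Γ₁ (fun p => ∃ q ∈ Γ₂, ψ.Sends p q ∧ φ.Sends q p) ∧
    Generically Γ₂ (fun q => ∃ p ∈ Γ₁, φ.Sends q p ∧ ψ.Sends p q)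

/-- `α` is a birational map from the line to itself. -/
def LineMap.IsBirational (α : LineMap) : Prop :=
  ∃ β : LineMap,
    Generically Set.univ (fun s : ℂ => ∃ t, α.Sends s t ∧ β.Sends t s) ∧
    Generically Set.univ (fun t : ℂ => ∃ s, β.Sends t s ∧ α.Sends s t)

/-- `π₂ ∘ ψ = α ∘ π₁` as rational maps on `Γ₁`, where `π₁`, `π₂` are the projections to the first
coordinate. -/
def Covers (ψ : PlaneMap) (α : LineMap) (Γ₁ : Set (ℂ × ℂ)) : Prop :=
  Generically Γ₁ fun p => ∃ q, ψ.Sends p q ∧ α.Sends p.1 q.1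

/-- `ψ ∘ h₁ = h₂ ∘ ψ` as rational maps `Γ₁ ⇢ Γ₂`: the map `ψ : Γ₁ ⇢ Γ₂` conjugates the restriction
of `h₁` to `Γ₁` to the restriction of `h₂` to `Γ₂`. -/
def ConjugatesRestrictions (ψ : PlaneMap) (h₁ h₂ : dJo) (Γ₁ Γ₂ : Set (ℂ × ℂ)) : Prop :=
  Generically Γ₁ fun p => ∃ p' ∈ Γ₁, ∃ q ∈ Γ₂, ∃ q' ∈ Γ₂,
    (toPlaneMap h₁).Sends p p' ∧ ψ.Sends p' q' ∧ ψ.Sends p q ∧ (toPlaneMap h₂).Sends q q'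

end DeJonquieres

end

noncomputable section

open scoped Polynomial
open Filter

/-! Write `σᵢ = hᵢ ^ n`, an involution over the base. It acts on the fibres by a traceless matrix
over `ℂ[x]`, so its finite fixed points in a general fibre are the roots of a quadratic, and these
are exactly the two points of `Γᵢ` (`IsFixedLocus`). If `c` conjugates `h₁` to `h₂`, it carries
fixed points of `σ₁` to fixed points of `σ₂` (`IsFixedLocus.transport`); its restriction to `Γ₁` is
the required `ψ`, and its action on the base the required `α`.

Conversely, `α` is a homography, and since `y` is quadratic over `ℂ(x)` on `Γ₁`, the second
coordinate of `ψ` agrees there with a quotient of two expressions linear in `y`. Hence `ψ` extends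
to an element of `dJo` (`exists_extension`). Conjugating by it, and choosing a base coordinate on
which the action is `x ↦ ζ x` (`exists_eigencoordinate`), one may assume that both elements act as
`x ↦ ζ x` and agree, in infinitely many fibres, at two points fixed by both involutions.

Such elements are conjugate over the base (`isConj_of_agree`). Let `M₁`, `M₂` be their fibre
matrices and `θ` the automorphism `f(x) ↦ f(ζ x)`. The `n`-th powers of the two semilinear maps are
matrices `A₁` and `A₂ = k A₁`. The matrix `adj(M₂) M₁` fixes the same two points as `A₁`, hence
commutes with it, and this forces `θ k = k`. Every non-zero invariant of `ℂ(x) / ℂ(xⁿ)` is a norm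
(`exists_cyclicNorm_eq`), so rescaling `M₂` gives `k = 1`. An averaging argument in the style of
Hilbert 90 (`exists_intertwiner`) then produces the conjugating matrix.

Rational maps are only partially defined, so the work on curves is done over cofinitely many points
of the base; finiteness of every fibre of `Γ` (`finite_fibre`) allows the return to all but finitely
many points of `Γ`. -/

namespace DeJonquieres

/-! ### Values of fractions at points. -/

section HasValue

variable {A : Type*} [CommRing A] {ev : A →+* ℂ} {f g : FractionRing A} {v w : ℂ}

/-- Cross-multiplication with the representation that witnesses the value; `b` itself may vanish at
the point. -/
theorem HasValue.eval_eq (h : HasValue ev f v) {a b : A}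
    (hab : f * algebraMap A (FractionRing A) b = algebraMap A (FractionRing A) a) :
    ev a = v * ev b := by
  obtain ⟨a', b', hb', h', rfl⟩ := h
  have : a * b' = a' * b := by
    apply IsFractionRing.injective A (FractionRing A)
    rw [map_mul, map_mul, ← hab, ← h']
    ring
  have h2 := congrArg ev this
  rw [map_mul, map_mul] at h2
  field_simp
  exact h2

theorem HasValue.unique (h : HasValue ev f v) (h' : HasValue ev f w) : v = w := by
  obtain ⟨a, b, hb, hab, rfl⟩ := h
  have := h'.eval_eq hab
  rw [this]
  field_simp

theorem hasValue_algebraMap (a : A) : HasValue ev (algebraMap A (FractionRing A) a) (ev a) :=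
  ⟨a, 1, by simp, by simp, by simp⟩

theorem HasValue.add (h : HasValue ev f v) (h' : HasValue ev g w) : HasValue ev (f + g) (v + w) := by
  obtain ⟨a, b, hb, hab, rfl⟩ := h
  obtain ⟨a', b', hb', hab', rfl⟩ := h'
  refine ⟨a * b' + a' * b, b * b', ?_, ?_, ?_⟩
  · rw [map_mul]; exact mul_ne_zero hb hb'
  · simp only [map_mul, map_add, ← hab, ← hab']; ring
  · simp only [map_mul, map_add]; field_simp

theorem HasValue.mul (h : HasValue ev f v) (h' : HasValue ev g w) : HasValue ev (f * g) (v * w) := by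
  obtain ⟨a, b, hb, hab, rfl⟩ := h
  obtain ⟨a', b', hb', hab', rfl⟩ := h'
  refine ⟨a * a', b * b', ?_, ?_, ?_⟩
  · rw [map_mul]; exact mul_ne_zero hb hb'
  · simp only [map_mul, ← hab, ← hab']; ring
  · simp only [map_mul]; field_simp

theorem HasValue.inv [IsDomain A] (h : HasValue ev f v) (hv : v ≠ 0) : HasValue ev f⁻¹ v⁻¹ := by
  obtain ⟨a, b, hb, hab, rfl⟩ := h
  have ha : ev a ≠ 0 := fun h => hv (by simp [h])
  refine ⟨b, a, ha, ?_, by simp⟩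
  have hf : f ≠ 0 := by
    rintro rfl
    rw [zero_mul] at hab
    have : a = 0 := IsFractionRing.injective A (FractionRing A) (by rw [← hab, map_zero])
    simp [this] at ha
  rw [← hab]
  field_simp

theorem HasValue.div [IsDomain A] (h : HasValue ev f v) (h' : HasValue ev g w) (hw : w ≠ 0) :
    HasValue ev (f / g) (v / w) := by
  rw [div_eq_mul_inv, div_eq_mul_inv]
  exact h.mul (h'.inv hw)

/-- A fraction in lowest terms computes all values of the fraction. -/
theorem exists_reduced (B : Type*) [CommRing B] [IsDomain B] [UniqueFactorizationMonoid B]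
    (f : FractionRing B) :
    ∃ P Q : B, Q ≠ 0 ∧ IsRelPrime P Q ∧
      f * algebraMap B (FractionRing B) Q = algebraMap B (FractionRing B) P ∧
      ∀ (ev : B →+* ℂ) (v : ℂ), HasValue ev f v → ev Q ≠ 0 := by
  obtain ⟨P, Q, hPQ, hf⟩ := IsFractionRing.exists_reduced_fraction (A := B) f
  have hf' : f * algebraMap B (FractionRing B) Q = algebraMap B (FractionRing B) P := by
    rw [← hf, IsLocalization.mk'_spec]
  refine ⟨P, Q, nonZeroDivisors.ne_zero Q.2, hPQ, hf', ?_⟩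
  rintro ev v ⟨a, b, hb, hab, -⟩ hQ
  have h1 : P * b = a * Q := by
    apply IsFractionRing.injective B (FractionRing B)
    rw [map_mul, map_mul, ← hab, ← hf']
    ring
  have h2 : (Q : B) ∣ b := hPQ.symm.dvd_of_dvd_mul_left ⟨a, by rw [h1, mul_comm]⟩
  obtain ⟨c, rfl⟩ := h2
  simp [hQ] at hb

end HasValue

/-! ### Clearing denominators: polynomial matrices for the base and fibre actions. -/

/-- Polynomials in `x`, as functions on the plane. -/
def ofPoly : ℂ[X] →+* FunctionField := (algebraMap ℂ[X][Y] FunctionField).comp Polynomial.C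

theorem ofPoly_injective : Function.Injective ofPoly :=
  (IsFractionRing.injective ℂ[X][Y] FunctionField).comp Polynomial.C_injective

@[simp] theorem ofPoly_X : ofPoly Polynomial.X = x := rfl

@[simp] theorem ofPoly_C (c : ℂ) : ofPoly (Polynomial.C c) = algebraMap ℂ FunctionField c := by
  rw [IsScalarTower.algebraMap_apply ℂ ℂ[X][Y] FunctionField]
  rfl

theorem ofPoly_eq_aeval (p : ℂ[X]) : ofPoly p = Polynomial.aeval x p := by
  induction p using Polynomial.induction_on with
  | C a => simp
  | add p q hp hq => simp [hp, hq]
  | monomial n a h => simp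

theorem ofPoly_eq_zero {p : ℂ[X]} : ofPoly p = 0 ↔ p = 0 :=
  map_eq_zero_iff _ ofPoly_injective

theorem ofPoly_mem (p : ℂ[X]) : ofPoly p ∈ ℂ⟮x⟯ := by
  rw [ofPoly_eq_aeval]
  exact (IntermediateField.algebra_adjoin_le_adjoin ℂ _)
    (Polynomial.aeval_mem_adjoin_singleton ℂ x)

theorem exists_ofPoly_of_mem {f : FunctionField} (hf : f ∈ ℂ⟮x⟯) :
    ∃ p q : ℂ[X], q ≠ 0 ∧ f * ofPoly q = ofPoly p := by
  rw [IntermediateField.mem_adjoin_simple_iff] at hf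
  obtain ⟨p, q, h⟩ := hf
  by_cases hq : q = 0
  · exact ⟨0, 1, one_ne_zero, by simp [h, hq]⟩
  · refine ⟨p, q, hq, ?_⟩
    have : ofPoly q ≠ 0 := by rwa [Ne, ofPoly_eq_zero]
    rw [h, ← ofPoly_eq_aeval, ← ofPoly_eq_aeval, div_mul_cancel₀ _ this]

/-- `w = (M₀₀ y + M₀₁) / (M₁₀ y + M₁₁)`. -/
def IsFibreForm (M : Matrix (Fin 2) (Fin 2) ℂ[X]) (w : FunctionField) : Prop :=
  w * (ofPoly (M 1 0) * y + ofPoly (M 1 1)) = ofPoly (M 0 0) * y + ofPoly (M 0 1)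

/-- The linear polynomial `a X + b`. -/
def lin (a b : ℂ) : ℂ[X] := Polynomial.C a * Polynomial.X + Polynomial.C b

@[simp] theorem eval_lin (a b s : ℂ) : (lin a b).eval s = a * s + b := by simp [lin]

/-- `u = (A₀₀ x + A₀₁) / (A₁₀ x + A₁₁)`. -/
def IsBaseForm (A : Matrix (Fin 2) (Fin 2) ℂ) (u : FunctionField) : Prop :=
  u * ofPoly (lin (A 1 0) (A 1 1)) = ofPoly (lin (A 0 0) (A 0 1))

theorem ofPoly_lin (a b : ℂ) :
    ofPoly (lin a b) = algebraMap ℂ FunctionField a * x + algebraMap ℂ FunctionField b := by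
  simp [lin]

theorem exists_isBaseForm {u : FunctionField} (h : IsMoebius ⊥ x u) :
    ∃ A : Matrix (Fin 2) (Fin 2) ℂ, A.det ≠ 0 ∧ IsBaseForm A u := by
  obtain ⟨a, ha, b, hb, c, hc, d, hd, hne, hs⟩ := h
  have h0 := moebius_denom_ne_zero x_notMem_bot hc hd hne
  rw [IntermediateField.mem_bot] at ha hb hc hd
  obtain ⟨a, rfl⟩ := ha
  obtain ⟨b, rfl⟩ := hb
  obtain ⟨c, rfl⟩ := hc
  obtain ⟨d, rfl⟩ := hd
  refine ⟨!![a, b; c, d], ?_, ?_⟩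
  · rw [Matrix.det_fin_two_of]
    intro h
    apply hne
    rw [← map_mul, ← map_mul, ← map_sub, h, map_zero]
  · simp only [IsBaseForm, Matrix.of_apply, Matrix.cons_val', Matrix.cons_val_zero,
      Matrix.cons_val_one, Matrix.cons_val_fin_one, ofPoly_lin]
    rw [hs, div_mul_cancel₀ _ h0]

theorem exists_isFibreForm {w : FunctionField} (h : IsMoebius ℂ⟮x⟯ y w) :
    ∃ M : Matrix (Fin 2) (Fin 2) ℂ[X], M.det ≠ 0 ∧ IsFibreForm M w := by
  obtain ⟨a, ha, b, hb, c, hc, d, hd, hne, hs⟩ := h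
  have h0 := moebius_denom_ne_zero y_notMem_adjoin_x hc hd hne
  obtain ⟨p₁, q₁, hq₁, h₁⟩ := exists_ofPoly_of_mem ha
  obtain ⟨p₂, q₂, hq₂, h₂⟩ := exists_ofPoly_of_mem hb
  obtain ⟨p₃, q₃, hq₃, h₃⟩ := exists_ofPoly_of_mem hc
  obtain ⟨p₄, q₄, hq₄, h₄⟩ := exists_ofPoly_of_mem hd
  refine ⟨!![p₁ * q₂ * q₃ * q₄, p₂ * q₁ * q₃ * q₄; p₃ * q₁ * q₂ * q₄, p₄ * q₁ * q₂ * q₃], ?_, ?_⟩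
  · rw [Matrix.det_fin_two_of]
    intro h
    have h' := congrArg ofPoly h
    simp only [map_sub, map_mul, map_zero, ← h₁, ← h₂, ← h₃, ← h₄] at h'
    have h1 : (a * d - b * c) * (ofPoly q₁ * ofPoly q₂ * ofPoly q₃ * ofPoly q₄) ^ 2 = 0 := by
      linear_combination h'
    simp [hne, ofPoly_eq_zero, hq₁, hq₂, hq₃, hq₄] at h1
  · simp only [IsFibreForm, Matrix.of_apply, Matrix.cons_val', Matrix.cons_val_zero,
      Matrix.cons_val_one, Matrix.cons_val_fin_one, map_mul, ← h₁, ← h₂, ← h₃, ← h₄]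
    have h1 : w * (c * y + d) = a * y + b := by rw [hs, div_mul_cancel₀ _ h0]
    linear_combination (ofPoly q₁ * ofPoly q₂ * ofPoly q₃ * ofPoly q₄) * h1

/-! ### Evaluation and composition at points of the plane. -/

/-- The rational function `f` is defined at `p` with value `v`. -/
abbrev ValueAt (p : ℂ × ℂ) (f : FunctionField) (v : ℂ) : Prop :=
  HasValue (Polynomial.evalEvalRingHom p.1 p.2) f v

theorem valueAt_ofPoly (p : ℂ × ℂ) (r : ℂ[X]) : ValueAt p (ofPoly r) (r.eval p.1) := by
  have := hasValue_algebraMap (ev := Polynomial.evalEvalRingHom p.1 p.2) (Polynomial.C r)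
  rwa [Polynomial.coe_evalEvalRingHom, Polynomial.evalEval_C] at this

theorem valueAt_x (p : ℂ × ℂ) : ValueAt p x p.1 := by
  simpa using valueAt_ofPoly p Polynomial.X

theorem valueAt_y (p : ℂ × ℂ) : ValueAt p y p.2 := by
  have := hasValue_algebraMap (ev := Polynomial.evalEvalRingHom p.1 p.2) Y
  rwa [Polynomial.coe_evalEvalRingHom, Polynomial.evalEval_X] at this

theorem valueAt_const (p : ℂ × ℂ) (c : ℂ) : ValueAt p (algebraMap ℂ FunctionField c) c := by
  simpa using valueAt_ofPoly p (Polynomial.C c)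

theorem ValueAt.ofPoly_comp {p : ℂ × ℂ} {φ : FunctionField →ₐ[ℂ] FunctionField} {s : ℂ}
    (h : ValueAt p (φ x) s) (r : ℂ[X]) : ValueAt p (φ (ofPoly r)) (r.eval s) := by
  induction r using Polynomial.induction_on with
  | C a => simpa using valueAt_const p a
  | add r q hr hq => simpa using hr.add hq
  | monomial n a hn =>
    have := hn.mul h
    rw [pow_succ, ← mul_assoc, map_mul, map_mul, ofPoly_X, Polynomial.eval_mul, Polynomial.eval_X]
    exact this

theorem ValueAt.poly_comp {p q : ℂ × ℂ} {φ : FunctionField →ₐ[ℂ] FunctionField}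
    (hx : ValueAt p (φ x) q.1) (hy : ValueAt p (φ y) q.2) (P : ℂ[X][Y]) :
    ValueAt p (φ (algebraMap ℂ[X][Y] FunctionField P)) (P.evalEval q.1 q.2) := by
  induction P using Polynomial.induction_on with
  | C a => rw [Polynomial.evalEval_C]; exact hx.ofPoly_comp a
  | add r q hr hq => simpa using hr.add hq
  | monomial n a hn =>
    have := hn.mul hy
    rw [pow_succ, ← mul_assoc, map_mul, map_mul, Polynomial.evalEval_mul, Polynomial.evalEval_X]
    exact this

theorem ValueAt.comp {p q : ℂ × ℂ} {φ : FunctionField →ₐ[ℂ] FunctionField}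
    (hx : ValueAt p (φ x) q.1) (hy : ValueAt p (φ y) q.2) {f : FunctionField} {v : ℂ}
    (hf : ValueAt q f v) : ValueAt p (φ f) v := by
  obtain ⟨a, b, hb, hab, rfl⟩ := hf
  have hb0 : algebraMap ℂ[X][Y] FunctionField b ≠ 0 := by
    rw [Ne, map_eq_zero_iff _ (IsFractionRing.injective ℂ[X][Y] FunctionField)]
    rintro rfl
    simp at hb
  rw [eq_div_of_mul_eq hb0 hab, map_div₀]
  exact (ValueAt.poly_comp hx hy a).div (ValueAt.poly_comp hx hy b) hb

/-- The birational transformation `g` is defined at `p` and sends `p` to `q`. -/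
abbrev SendsPt (g : dJo) (p q : ℂ × ℂ) : Prop := (toPlaneMap g).Sends p q

theorem pullback_mul (g h : Bir) (f : FunctionField) :
    pullback (g * h) f = pullback h (pullback g f) := rfl

theorem SendsPt.comp {g : dJo} {p q : ℂ × ℂ} (hg : SendsPt g p q) {f : FunctionField} {v : ℂ}
    (hf : ValueAt q f v) : ValueAt p (pullback g f) v :=
  ValueAt.comp (φ := (g : Bir).unop) hg.1 hg.2 hf

theorem SendsPt.mul {g h : dJo} {p q r : ℂ × ℂ} (hh : SendsPt h p q) (hg : SendsPt g q r) :
    SendsPt (g * h) p r :=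
  ⟨hh.comp hg.1, hh.comp hg.2⟩

theorem SendsPt.unique {g : dJo} {p q r : ℂ × ℂ} (h : SendsPt g p q) (h' : SendsPt g p r) : q = r :=
  Prod.ext (h.1.unique h'.1) (h.2.unique h'.2)

theorem sendsPt_one (p : ℂ × ℂ) : SendsPt 1 p p := ⟨valueAt_x p, valueAt_y p⟩

theorem dJo_ext {g h : dJo} (hx : pullback g x = pullback h x) (hy : pullback g y = pullback h y) :
    g = h := by
  apply Subtype.ext
  apply MulOpposite.unop_injective
  apply AlgEquiv.ext
  intro f
  have hr : ∀ r : ℂ[X], pullback g (ofPoly r) = pullback h (ofPoly r) := by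
    intro r
    simp only [ofPoly_eq_aeval]
    have h1 := Polynomial.aeval_algHom_apply ((g : Bir).unop : FunctionField →ₐ[ℂ] FunctionField) x r
    have h2 := Polynomial.aeval_algHom_apply ((h : Bir).unop : FunctionField →ₐ[ℂ] FunctionField) x r
    refine h1.symm.trans (Eq.trans ?_ h2)
    exact congrArg (fun z => Polynomial.aeval z r) hx
  have hP : ∀ P : ℂ[X][Y], pullback g (algebraMap _ _ P) = pullback h (algebraMap _ _ P) := by
    intro P
    simp only [pullback] at *
    induction P using Polynomial.induction_on with
    | C a => exact hr a
    | add r q hr hq => simp only [map_add, hr, hq]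
    | monomial n a hn =>
      have hy' : (g : Bir).unop (algebraMap ℂ[X][Y] FunctionField Y) =
        (h : Bir).unop (algebraMap ℂ[X][Y] FunctionField Y) := hy
      simp only [pow_succ, ← mul_assoc, map_mul] at hn ⊢
      rw [hn, hy']
  obtain ⟨a, b, hb, rfl⟩ := IsFractionRing.div_surjective (A := ℂ[X][Y]) f
  have ha' := hP a
  have hb' := hP b
  simp only [pullback] at ha' hb'
  rw [map_div₀, map_div₀, ha', hb']

theorem HasValue.of_mul {A : Type*} [CommRing A] [IsDomain A] {ev : A →+* ℂ}
    {f g : FractionRing A} {v w : ℂ} (hg : HasValue ev g w) (hw : w ≠ 0)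
    (hfg : HasValue ev (f * g) v) : HasValue ev f (v / w) := by
  have hg0 : g ≠ 0 := by
    rintro rfl
    have := hasValue_algebraMap (ev := ev) 0
    rw [map_zero, map_zero] at this
    exact hw (hg.unique this)
  rw [← mul_div_cancel_right₀ f hg0]
  exact hfg.div hg hw

theorem valueAt_fibre_linear (p : ℂ × ℂ) (a b : ℂ[X]) :
    ValueAt p (ofPoly a * y + ofPoly b) (a.eval p.1 * p.2 + b.eval p.1) :=
  ((valueAt_ofPoly p a).mul (valueAt_y p)).add (valueAt_ofPoly p b)

theorem IsFibreForm.eval_eq {M : Matrix (Fin 2) (Fin 2) ℂ[X]} {w : FunctionField} {p : ℂ × ℂ}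
    {t : ℂ} (h : IsFibreForm M w) (hv : ValueAt p w t) :
    t * ((M 1 0).eval p.1 * p.2 + (M 1 1).eval p.1) =
      (M 0 0).eval p.1 * p.2 + (M 0 1).eval p.1 := by
  have h1 := hv.mul (valueAt_fibre_linear p (M 1 0) (M 1 1))
  rw [show w * _ = _ from h] at h1
  exact h1.unique (valueAt_fibre_linear p _ _)

theorem IsFibreForm.valueAt {M : Matrix (Fin 2) (Fin 2) ℂ[X]} {w : FunctionField} {p : ℂ × ℂ}
    (h : IsFibreForm M w) (hne : (M 1 0).eval p.1 * p.2 + (M 1 1).eval p.1 ≠ 0) :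
    ValueAt p w (((M 0 0).eval p.1 * p.2 + (M 0 1).eval p.1) /
      ((M 1 0).eval p.1 * p.2 + (M 1 1).eval p.1)) := by
  refine HasValue.of_mul (valueAt_fibre_linear p (M 1 0) (M 1 1)) hne ?_
  rw [show w * _ = _ from h]
  exact valueAt_fibre_linear p _ _

theorem IsBaseForm.eval_eq {A : Matrix (Fin 2) (Fin 2) ℂ} {u : FunctionField} {p : ℂ × ℂ}
    {s : ℂ} (h : IsBaseForm A u) (hv : ValueAt p u s) :
    s * (A 1 0 * p.1 + A 1 1) = A 0 0 * p.1 + A 0 1 := by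
  have h1 := hv.mul (valueAt_ofPoly p (lin (A 1 0) (A 1 1)))
  rw [show u * _ = _ from h] at h1
  simpa using h1.unique (valueAt_ofPoly p _)

theorem IsBaseForm.valueAt {A : Matrix (Fin 2) (Fin 2) ℂ} {u : FunctionField} {p : ℂ × ℂ}
    (h : IsBaseForm A u) (hne : A 1 0 * p.1 + A 1 1 ≠ 0) :
    ValueAt p u ((A 0 0 * p.1 + A 0 1) / (A 1 0 * p.1 + A 1 1)) := by
  have h1 := valueAt_ofPoly p (lin (A 1 0) (A 1 1))
  have h2 := valueAt_ofPoly p (lin (A 0 0) (A 0 1))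
  rw [← show u * _ = _ from h] at h2
  rw [eval_lin] at h1 h2
  exact HasValue.of_mul h1 hne h2

/-! ### Generic points of the base and construction of elements of `dJo`. -/

theorem eventually_eval_ne_zero {p : ℂ[X]} (hp : p ≠ 0) : ∀ᶠ s in cofinite, p.eval s ≠ 0 := by
  rw [eventually_cofinite]
  refine (p.roots.toFinset.finite_toSet).subset ?_
  intro s hs
  simpa [hp] using hs

/-- Homographies of the line preserve the cofinite filter. -/
theorem eventually_moebius {A : Matrix (Fin 2) (Fin 2) ℂ} (hA : A.det ≠ 0) {P : ℂ → Prop}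
    (hP : ∀ᶠ s in cofinite, P s) :
    ∀ᶠ s in cofinite, A 1 0 * s + A 1 1 ≠ 0 ∧
      ∀ s', s' * (A 1 0 * s + A 1 1) = A 0 0 * s + A 0 1 → P s' := by
  rw [Matrix.det_fin_two] at hA
  have key : ∀ u v : ℂ, (u ≠ 0 ∨ v ≠ 0) → {s : ℂ | u * s + v = 0}.Finite := by
    intro u v huv
    by_cases hu : u = 0
    · have : {s : ℂ | u * s + v = 0} = ∅ := by
        ext s
        simp_all
      rw [this]
      exact Set.finite_empty
    · refine (Set.finite_singleton (-v / u)).subset ?_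
      intro s hs
      simp only [Set.mem_ofPred_eq, Set.mem_singleton_iff] at hs ⊢
      field_simp
      linear_combination hs
  have h1 : ∀ᶠ s in cofinite, A 1 0 * s + A 1 1 ≠ 0 := by
    rw [eventually_cofinite]
    refine (key (A 1 0) (A 1 1) ?_).subset fun s hs => not_not.1 hs
    by_contra! h
    simp [h.1, h.2] at hA
  refine h1.and ?_
  rw [eventually_cofinite] at hP ⊢
  -- For each bad value `s'`, the points sent to it solve one linear equation, which is non-trivial
  -- because `det A ≠ 0`.
  refine (hP.biUnion (t := fun s' => {s | (A 0 0 - s' * A 1 0) * s + (A 0 1 - s' * A 1 1) = 0})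
    fun s' _ => key _ _ ?_).subset ?_
  · by_contra! h
    apply hA
    linear_combination A 1 1 * h.1 - A 1 0 * h.2
  · intro s hs
    simp only [Set.mem_ofPred_eq, not_forall] at hs
    obtain ⟨s', h, hs'⟩ := hs
    simp only [Set.mem_iUnion]
    exact ⟨s', hs', by simp only [Set.mem_ofPred_eq]; linear_combination -h⟩

theorem valueAt_aevalAeval {p q : ℂ × ℂ} {u w : FunctionField} (hu : ValueAt p u q.1)
    (hw : ValueAt p w q.2) (P : ℂ[X][Y]) :
    ValueAt p (Polynomial.aevalAeval u w P) (P.evalEval q.1 q.2) := by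
  have hr : ∀ r : ℂ[X], ValueAt p (Polynomial.aeval u r) (r.eval q.1) := by
    intro r
    induction r using Polynomial.induction_on with
    | C a => simpa using valueAt_const p a
    | add r q hr hq => simpa using hr.add hq
    | monomial n a hn =>
      have := hn.mul hu
      rw [pow_succ, ← mul_assoc, map_mul, Polynomial.aeval_X, Polynomial.eval_mul,
        Polynomial.eval_X]
      exact this
  induction P using Polynomial.induction_on with
  | C a => rw [Polynomial.evalEval_C, Polynomial.aevalAeval_C]; exact hr a
  | add r q hr hq => rw [map_add, Polynomial.evalEval_add]; exact hr.add hq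
  | monomial n a hn =>
    have := hn.mul hw
    rw [pow_succ, ← mul_assoc, map_mul, Polynomial.aevalAeval_Y, Polynomial.evalEval_mul,
      Polynomial.evalEval_X]
    exact this

/-- Algebraic independence by evaluation: for general `s` the polynomial `P(s', ·)` is non-zero at
the image `s'` of `s`, and a general `t` is then moved off its roots, so `P(u, w)` has a non-zero
value. -/
theorem aevalAeval_injective {u w : FunctionField} (hu : IsMoebius ⊥ x u)
    (hw : IsMoebius ℂ⟮x⟯ y w) :
    Function.Injective (Polynomial.aevalAeval (R := ℂ) u w) := by
  obtain ⟨A, hA, hAu⟩ := exists_isBaseForm hu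
  obtain ⟨M, hM, hMw⟩ := exists_isFibreForm hw
  rw [injective_iff_map_eq_zero]
  intro P hP
  by_contra hP0
  obtain ⟨k, hk⟩ : ∃ k, P.coeff k ≠ 0 := by
    by_contra! h
    exact hP0 (Polynomial.ext h)
  obtain ⟨s, hs, hs1, hs2⟩ := ((eventually_eval_ne_zero hM).and
    (eventually_moebius hA (eventually_eval_ne_zero hk))).exists
  set s' := (A 0 0 * s + A 0 1) / (A 1 0 * s + A 1 1)
  have hk' := hs2 s' (div_mul_cancel₀ _ hs1)
  have hPs : P.map (Polynomial.evalRingHom s') ≠ 0 := by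
    intro h
    have := congrArg (fun q => Polynomial.coeff q k) h
    rw [Polynomial.coeff_map] at this
    exact hk' (by simpa using this)
  set N : Matrix (Fin 2) (Fin 2) ℂ := M.map (Polynomial.eval s) with hN
  have hNdet : N.det ≠ 0 := by
    rw [Matrix.det_fin_two] at hs ⊢
    simpa [hN] using hs
  obtain ⟨t, ht1, ht2⟩ := (eventually_moebius hNdet (eventually_eval_ne_zero hPs)).exists
  set t' := (N 0 0 * t + N 0 1) / (N 1 0 * t + N 1 1)
  have h1 := ht2 t' (div_mul_cancel₀ _ ht1)
  have h2 : ValueAt (s, t) u s' := hAu.valueAt hs1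
  have h3 : ValueAt (s, t) w t' := hMw.valueAt ht1
  have h4 := valueAt_aevalAeval (q := (s', t')) h2 h3 P
  rw [hP] at h4
  have h5 := valueAt_const (s, t) 0
  rw [map_zero] at h5
  have h6 := h4.unique h5
  apply h1
  rw [← h6, Polynomial.eval_map]
  exact congrFun (Polynomial.eval₂_evalRingHom s' ▸ rfl) _

/-- Independence extends the substitution to the fraction field. It is onto because inverse
homographies recover `x` from `u` over `ℂ`, and then `y` from `w` over `ℂ(x)`. -/
theorem exists_dJo {u w : FunctionField} (hu : IsMoebius ⊥ x u) (hw : IsMoebius ℂ⟮x⟯ y w) :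
    ∃ g : dJo, pullback g x = u ∧ pullback g y = w := by
  have hinj := aevalAeval_injective hu hw
  let Φ : FunctionField →ₐ[ℂ] FunctionField := IsFractionRing.liftAlgHom hinj
  have hΦ : ∀ P, Φ (algebraMap ℂ[X][Y] FunctionField P) = Polynomial.aevalAeval (R := ℂ) u w P :=
    fun P => IsFractionRing.lift_algebraMap hinj P
  have hΦx : Φ x = u := by rw [x, hΦ, Polynomial.aevalAeval_X]
  have hΦy : Φ y = w := by rw [y, hΦ, Polynomial.aevalAeval_Y]
  have hx : x ∈ Φ.fieldRange := by
    obtain ⟨a, ha, b, hb, c, hc, d, hd, -, h⟩ := hu.symm x_notMem_bot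
    have hle : (⊥ : IntermediateField ℂ FunctionField) ≤ Φ.fieldRange := bot_le
    have hum : u ∈ Φ.fieldRange := ⟨x, hΦx⟩
    rw [h]
    exact div_mem (add_mem (mul_mem (hle ha) hum) (hle hb))
      (add_mem (mul_mem (hle hc) hum) (hle hd))
  have hy : y ∈ Φ.fieldRange := by
    obtain ⟨a, ha, b, hb, c, hc, d, hd, -, h⟩ := hw.symm y_notMem_adjoin_x
    have hle : ℂ⟮x⟯ ≤ Φ.fieldRange := by
      rw [IntermediateField.adjoin_simple_le_iff]
      exact hx
    have hwm : w ∈ Φ.fieldRange := ⟨y, hΦy⟩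
    rw [h]
    exact div_mem (add_mem (mul_mem (hle ha) hwm) (hle hb))
      (add_mem (mul_mem (hle hc) hwm) (hle hd))
  have hP : ∀ P : ℂ[X][Y], algebraMap ℂ[X][Y] FunctionField P ∈ Φ.fieldRange := by
    intro P
    have hle : ℂ⟮x⟯ ≤ Φ.fieldRange := by
      rw [IntermediateField.adjoin_simple_le_iff]
      exact hx
    induction P using Polynomial.induction_on with
    | C a => exact hle (ofPoly_mem a)
    | add r q hr hq => rw [map_add]; exact add_mem hr hq
    | monomial n a hn => rw [pow_succ, ← mul_assoc, map_mul]; exact mul_mem hn hy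
  have hsurj : Function.Surjective Φ := by
    intro f
    obtain ⟨a, b, -, rfl⟩ := IsFractionRing.div_surjective (A := ℂ[X][Y]) f
    exact div_mem (hP a) (hP b)
  let e : FunctionField ≃ₐ[ℂ] FunctionField := AlgEquiv.ofBijective Φ ⟨Φ.toRingHom.injective, hsurj⟩
  have hex : pullback (MulOpposite.op e) x = u := hΦx
  have hey : pullback (MulOpposite.op e) y = w := hΦy
  exact ⟨⟨MulOpposite.op e, by rw [hex]; exact hu, by rw [hey]; exact hw⟩, hex, hey⟩

/-- `A` describes the action of `g` on the base and `M` its action on the fibres. -/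
structure HasForm (g : dJo) (A : Matrix (Fin 2) (Fin 2) ℂ) (M : Matrix (Fin 2) (Fin 2) ℂ[X]) :
    Prop where
  det_base : A.det ≠ 0
  base : IsBaseForm A (pullback g x)
  det_fibre : M.det ≠ 0
  fibre : IsFibreForm M (pullback g y)

theorem exists_hasForm (g : dJo) : ∃ A M, HasForm g A M := by
  obtain ⟨A, hA, hA'⟩ := exists_isBaseForm g.2.1
  obtain ⟨M, hM, hM'⟩ := exists_isFibreForm g.2.2
  exact ⟨A, M, hA, hA', hM, hM'⟩

/-- A property of points of the base that holds generically holds at the images of general points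
under `g`. -/
theorem eventually_sends (g : dJo) {P : ℂ → Prop} (hP : ∀ᶠ s in cofinite, P s) :
    ∀ᶠ s in cofinite, ∀ t q, SendsPt g (s, t) q → P q.1 := by
  obtain ⟨A, M, h⟩ := exists_hasForm g
  filter_upwards [eventually_moebius h.det_base hP] with s hs t q hq
  exact hs.2 _ (h.base.eval_eq hq.1)

/-- At a general point where `g` is defined, `g⁻¹` is defined at the image. -/
theorem eventually_sends_inv (g : dJo) :
    ∀ᶠ s in cofinite, ∀ t q, SendsPt g (s, t) q → SendsPt g⁻¹ q (s, t) := by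
  obtain ⟨A, M, h⟩ := exists_hasForm g⁻¹
  have hinv : ∀ f, pullback g (pullback (g⁻¹ : dJo) f) = f := fun f =>
    (g : Bir).unop.apply_symm_apply f
  have hM := eventually_eval_ne_zero h.det_fibre
  filter_upwards [eventually_sends g hM] with s hs t q hq
  have hdet := hs t q hq
  -- Pulling the form of `g⁻¹` back by `g` gives a relation for `x` itself: if the denominator
  -- vanished at `q`, so would the numerator, against `det A ≠ 0`. The fibre coordinate is treated
  -- in the same way.
  have hA1 : A 1 0 * q.1 + A 1 1 ≠ 0 := by
    intro h0
    have h1 := hq.comp (valueAt_ofPoly q (lin (A 1 0) (A 1 1)))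
    have h2 := hq.comp (valueAt_ofPoly q (lin (A 0 0) (A 0 1)))
    have h3 := congrArg (pullback g) h.base
    have h4 : pullback g (pullback (g⁻¹ : dJo) x) * pullback g (ofPoly (lin (A 1 0) (A 1 1))) =
      pullback g (ofPoly (lin (A 0 0) (A 0 1))) := by
      rw [← h3]; exact (map_mul (g : Bir).unop _ _).symm
    rw [hinv] at h4
    rw [← h4] at h2
    have h5 := h2.unique ((valueAt_x (s, t)).mul h1)
    simp only [eval_lin, h0, mul_zero] at h5
    apply h.det_base
    rw [Matrix.det_fin_two]
    by_cases hc : A 1 0 = 0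
    · have : A 1 1 = 0 := by simpa [hc] using h0
      simp [hc, this]
    · apply mul_left_cancel₀ hc
      linear_combination A 1 0 * A 0 0 * h0 - A 1 0 * A 1 0 * h5
  have hM1 : (M 1 0).eval q.1 * q.2 + (M 1 1).eval q.1 ≠ 0 := by
    intro h0
    have h1 := hq.comp (valueAt_fibre_linear q (M 1 0) (M 1 1))
    have h2 := hq.comp (valueAt_fibre_linear q (M 0 0) (M 0 1))
    have h3 := congrArg (pullback g) h.fibre
    have h4 : pullback g (pullback (g⁻¹ : dJo) y) * pullback g (ofPoly (M 1 0) * y + ofPoly (M 1 1)) =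
      pullback g (ofPoly (M 0 0) * y + ofPoly (M 0 1)) := by
      rw [← h3]; exact (map_mul (g : Bir).unop _ _).symm
    rw [hinv] at h4
    rw [← h4] at h2
    have h5 := h2.unique ((valueAt_y (s, t)).mul h1)
    rw [h0, mul_zero] at h5
    apply hdet
    rw [Matrix.det_fin_two, Polynomial.eval_sub, Polynomial.eval_mul, Polynomial.eval_mul]
    by_cases hc : (M 1 0).eval q.1 = 0
    · have : (M 1 1).eval q.1 = 0 := by simpa [hc] using h0
      simp [hc, this]
    · apply mul_left_cancel₀ hc
      linear_combination (M 1 0).eval q.1 * (M 0 0).eval q.1 * h0 -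
        (M 1 0).eval q.1 * (M 1 0).eval q.1 * h5
  have h1 : SendsPt g⁻¹ q (_, _) := ⟨h.base.valueAt hA1, h.fibre.valueAt hM1⟩
  have h2 := hq.mul h1
  rw [inv_mul_cancel] at h2
  rwa [h2.unique (sendsPt_one _)] at h1

/-! ### Involutions over the base and their fixed curves. -/

theorem ofPoly_quadratic_eq_zero {a b c : ℂ[X]}
    (h : ofPoly a * y ^ 2 + ofPoly b * y + ofPoly c = 0) : a = 0 ∧ b = 0 ∧ c = 0 := by
  have h1 : algebraMap ℂ[X][Y] FunctionField
      (Polynomial.C a * Y ^ 2 + Polynomial.C b * Y + Polynomial.C c) = 0 := by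
    rw [map_add, map_add, map_mul, map_mul, map_pow]
    exact h
  have h2 := (map_eq_zero_iff _ (IsFractionRing.injective ℂ[X][Y] FunctionField)).1 h1
  exact ⟨by simpa [Polynomial.coeff_X, Polynomial.coeff_C]
      using congrArg (fun p => Polynomial.coeff p 2) h2,
    by simpa [Polynomial.coeff_X, Polynomial.coeff_C, Polynomial.coeff_X_pow]
      using congrArg (fun p => Polynomial.coeff p 1) h2,
    by simpa [Polynomial.coeff_X, Polynomial.coeff_C, Polynomial.coeff_X_pow]
      using congrArg (fun p => Polynomial.coeff p 0) h2⟩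

theorem y_ne_zero : y ≠ 0 := fun h => y_notMem_adjoin_x (h ▸ zero_mem _)

theorem fibre_linear_eq_zero {a b : ℂ[X]} (h : ofPoly a * y + ofPoly b = 0) : a = 0 ∧ b = 0 := by
  obtain ⟨-, ha, hb⟩ := ofPoly_quadratic_eq_zero (a := 0) (b := a) (c := b) (by simpa using h)
  exact ⟨ha, hb⟩

theorem fibre_denom_ne_zero {M : Matrix (Fin 2) (Fin 2) ℂ[X]}
    (hM : M.det ≠ 0) : ofPoly (M 1 0) * y + ofPoly (M 1 1) ≠ 0 := by
  intro h
  obtain ⟨h1, h2⟩ := fibre_linear_eq_zero h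
  rw [Matrix.det_fin_two, h1, h2] at hM
  simp at hM

theorem pullback_ofPoly_of_base {σ : dJo} (h : pullback σ x = x) (r : ℂ[X]) :
    pullback σ (ofPoly r) = ofPoly r := by
  rw [ofPoly_eq_aeval]
  have := Polynomial.aeval_algHom_apply ((σ : Bir).unop : FunctionField →ₐ[ℂ] FunctionField) x r
  exact this.symm.trans (congrArg (fun z => Polynomial.aeval z r) h)

theorem pullback_add (g : Bir) (f f' : FunctionField) :
    pullback g (f + f') = pullback g f + pullback g f' := map_add g.unop f f'

theorem pullback_mul_apply (g : Bir) (f f' : FunctionField) :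
    pullback g (f * f') = pullback g f * pullback g f' := map_mul g.unop f f'

theorem pullback_one_apply (g : Bir) : pullback g 1 = 1 := map_one g.unop

/-- An involution acting trivially on the base is given by a matrix of trace zero. -/
theorem exists_traceless_form {σ : dJo} (hb : pullback σ x = x) (h2 : σ * σ = 1) (h1 : σ ≠ 1) :
    ∃ S : Matrix (Fin 2) (Fin 2) ℂ[X], S.det ≠ 0 ∧ S 1 1 = -S 0 0 ∧
      IsFibreForm S (pullback σ y) := by
  obtain ⟨M, hM, hf⟩ := exists_isFibreForm σ.2.2
  refine ⟨M, hM, ?_, hf⟩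
  set w := pullback σ y with hw
  have hD := fibre_denom_ne_zero hM
  have hwy : pullback σ w = y := by
    rw [hw, ← pullback_mul, ← Subgroup.coe_mul, h2]
    rfl
  have e1 : w * (ofPoly (M 1 0) * y + ofPoly (M 1 1)) = ofPoly (M 0 0) * y + ofPoly (M 0 1) := hf
  have e2 := congrArg (pullback σ) e1
  simp only [pullback_add, pullback_mul_apply, pullback_ofPoly_of_base hb, hwy, ← hw] at e2
  -- Eliminating `w` between the form of `σ` and its pullback leaves a quadratic in `y` whose
  -- coefficients are all multiples of the trace. A non-zero trace would make `M` scalar, hence `σ =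
  -- 1`.
  have e3 : ofPoly (M 1 0 * (M 0 0 + M 1 1)) * y ^ 2 +
      ofPoly ((M 1 1 - M 0 0) * (M 0 0 + M 1 1)) * y +
      ofPoly (-(M 0 1 * (M 0 0 + M 1 1))) = 0 := by
    simp only [map_add, map_mul, map_sub, map_neg]
    linear_combination (ofPoly (M 1 0) * y + ofPoly (M 1 1)) * e2 -
      (ofPoly (M 1 0) * y - ofPoly (M 0 0)) * e1
  obtain ⟨c1, c2, c3⟩ := ofPoly_quadratic_eq_zero e3
  by_contra hne
  have htr : M 0 0 + M 1 1 ≠ 0 := fun h => hne (by linear_combination h)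
  have c1' : M 1 0 = 0 := (mul_eq_zero.1 c1).resolve_right htr
  have c2' : M 1 1 = M 0 0 := sub_eq_zero.1 ((mul_eq_zero.1 c2).resolve_right htr)
  have c3' : M 0 1 = 0 := (mul_eq_zero.1 (neg_eq_zero.1 c3)).resolve_right htr
  apply h1
  apply dJo_ext
  · exact hb
  · rw [c1', c2', c3'] at e1
    simp only [map_zero, zero_mul, zero_add, add_zero] at e1
    have h0 : ofPoly (M 0 0) ≠ 0 := by
      rw [Ne, ofPoly_eq_zero]
      intro h
      apply htr
      rw [c2', h, add_zero]
    have : w = y := mul_right_cancel₀ h0 (by rw [e1, mul_comm])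
    exact this

/-- The homography of the fibre over `s` given by `M` fixes `t`. -/
def FixesAt (M : Matrix (Fin 2) (Fin 2) ℂ[X]) (s t : ℂ) : Prop :=
  t * ((M 1 0).eval s * t + (M 1 1).eval s) = (M 0 0).eval s * t + (M 0 1).eval s

theorem Generically.eventually {Γ : Set (ℂ × ℂ)} {P : ℂ × ℂ → Prop} (h : Generically Γ P) :
    ∀ᶠ s in cofinite, ∀ t, (s, t) ∈ Γ → P (s, t) := by
  rw [eventually_cofinite]
  refine (h.image Prod.fst).subset ?_
  intro s hs
  simp only [Set.mem_ofPred_eq, not_forall] at hs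
  obtain ⟨t, ht, hp⟩ := hs
  exact ⟨(s, t), ⟨ht, hp⟩, rfl⟩

/-- Discarding finitely many base points discards finitely many points of `Γ` only because the
fibres are finite. -/
theorem generically_of_eventually {Γ : Set (ℂ × ℂ)} {P : ℂ × ℂ → Prop}
    (hΓ : ∀ s, {p ∈ Γ | p.1 = s}.Finite)
    (h : ∀ᶠ s in cofinite, ∀ t, (s, t) ∈ Γ → P (s, t)) : Generically Γ P := by
  rw [eventually_cofinite] at h
  refine (h.biUnion fun s _ => hΓ s).subset ?_
  rintro ⟨s, t⟩ ⟨hp, hP⟩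
  simp only [Set.mem_iUnion]
  refine ⟨s, ?_, hp, rfl⟩
  simp only [Set.mem_ofPred_eq, not_forall]
  exact ⟨t, hp, hP⟩

/-- The fixed points are the roots of `S₁₀ t² - 2 S₀₀ t - S₀₁`. Two points of `Γ` are distinct
roots, so `S₁₀ = 0` would give `S₀₀ = 0` and then `det S = 0`. Being a true quadratic, it has no
third root. -/
theorem eventually_fixed_fibre {σ : dJo} {Γ : Set (ℂ × ℂ)} (hfix : FixesCurve σ Γ)
    (hdeg : IsTwoToOne Γ) {S : Matrix (Fin 2) (Fin 2) ℂ[X]} (hS : S.det ≠ 0)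
    (htr : S 1 1 = -S 0 0) (hf : IsFibreForm S (pullback σ y)) :
    ∀ᶠ s in cofinite, (S 1 0).eval s ≠ 0 ∧ (∀ t, (s, t) ∈ Γ ↔ FixesAt S s t) ∧
      ∃ t₁ t₂, t₁ ≠ t₂ ∧ (s, t₁) ∈ Γ ∧ (s, t₂) ∈ Γ := by
  have hdeg' : ∀ᶠ s in cofinite, {p ∈ Γ | p.1 = s}.ncard = 2 := by
    rw [eventually_cofinite]
    simpa [IsTwoToOne, Generically] using hdeg
  filter_upwards [Generically.eventually hfix, hdeg', eventually_eval_ne_zero hS] with s h1 h2 h3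
  rw [Set.ncard_eq_two] at h2
  obtain ⟨⟨s₁, t₁⟩, ⟨s₂, t₂⟩, hne, h2⟩ := h2
  have m1 : (s₁, t₁) ∈ {p ∈ Γ | p.1 = s} := by rw [h2]; simp
  have m2 : (s₂, t₂) ∈ {p ∈ Γ | p.1 = s} := by rw [h2]; simp
  obtain ⟨g1, rfl⟩ := m1
  obtain ⟨g2, e⟩ := m2
  simp only at e h1 h2 h3
  subst e
  have hne' : t₁ ≠ t₂ := fun h => hne (by rw [h])
  have hfx : ∀ t, (s₂, t) ∈ Γ → FixesAt S s₂ t := fun t ht => hf.eval_eq (h1 t ht).2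
  have f1 := hfx _ g1
  have f2 := hfx _ g2
  rw [FixesAt, htr, Polynomial.eval_neg] at f1 f2
  rw [Matrix.det_fin_two, htr] at h3
  simp only [Polynomial.eval_sub, Polynomial.eval_mul, Polynomial.eval_neg] at h3
  have hd : t₁ - t₂ ≠ 0 := sub_ne_zero.2 hne'
  have e1 : (S 1 0).eval s₂ * (t₁ + t₂) = 2 * (S 0 0).eval s₂ := by
    apply mul_left_cancel₀ hd
    linear_combination f1 - f2
  have h10 : (S 1 0).eval s₂ ≠ 0 := by
    intro h0
    have h00 : (S 0 0).eval s₂ = 0 := by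
      rw [h0] at e1
      linear_combination -(1 / 2) * e1
    apply h3
    rw [h0, h00]
    ring
  refine ⟨h10, fun t => ⟨hfx t, fun ht => ?_⟩, t₁, t₂, hne', g1, g2⟩
  rw [FixesAt, htr, Polynomial.eval_neg] at ht
  have : (S 1 0).eval s₂ * ((t - t₁) * (t - t₂)) = 0 := by
    linear_combination ht - t * e1 + t₁ * e1 - f1
  rcases mul_eq_zero.1 ((mul_eq_zero.1 this).resolve_left h10) with h | h
  · rwa [sub_eq_zero.1 h]
  · rwa [sub_eq_zero.1 h]

/-- A non-zero polynomial matrix is, up to a scalar factor, non-zero at any given point. -/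
theorem exists_eval_ne_zero (s : ℂ) (S : Matrix (Fin 2) (Fin 2) ℂ[X]) (hS : S ≠ 0) :
    ∃ (e : ℂ[X]) (S' : Matrix (Fin 2) (Fin 2) ℂ[X]), e ≠ 0 ∧ S = e • S' ∧
      S'.map (Polynomial.eval s) ≠ 0 := by
  obtain ⟨i, j, hij⟩ : ∃ i j, S i j ≠ 0 := by
    by_contra! h
    exact hS (Matrix.ext h)
  -- Induction on the degree of a fixed non-zero entry: as long as `S` vanishes at `s`, divide by `X
  -- - s`.
  obtain ⟨N, hN⟩ : ∃ N, (S i j).natDegree < N := ⟨_, Nat.lt_succ_self _⟩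
  induction N generalizing S with
  | zero => omega
  | succ N ih =>
    by_cases h0 : S.map (Polynomial.eval s) = 0
    · have hdvd : ∀ k l, ∃ r, S k l = (Polynomial.X - Polynomial.C s) * r := by
        intro k l
        have : (S k l).eval s = 0 := congrFun (congrFun h0 k) l
        exact Polynomial.dvd_iff_isRoot.2 this
      choose T hT using hdvd
      have hST : S = (Polynomial.X - Polynomial.C s) • Matrix.of T := by
        ext1 k l
        exact hT k l
      have hTij : T i j ≠ 0 := by
        intro h
        rw [hT i j, h, mul_zero] at hij
        exact hij rfl
      obtain ⟨e, S', he, hS', hne⟩ := ih (Matrix.of T)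
        (fun h => hTij (congrFun (congrFun h i) j)) hTij (by
          have h1 := hT i j
          have h2 := Polynomial.natDegree_mul (Polynomial.X_sub_C_ne_zero s) hTij
          rw [← h1, Polynomial.natDegree_X_sub_C] at h2
          simp only [Matrix.of_apply]
          omega)
      refine ⟨(Polynomial.X - Polynomial.C s) * e, S',
        mul_ne_zero (Polynomial.X_sub_C_ne_zero s) he, ?_, hne⟩
      rw [hST, hS', smul_smul]
    · exact ⟨1, S, one_ne_zero, by simp, h0⟩

theorem eval_eq_zero_of_infinite {p : ℂ[X]} (h : ∃ᶠ s in cofinite, p.eval s = 0) : p = 0 := by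
  by_contra hp
  exact h (eventually_eval_ne_zero hp)

/-- An infinite fibre would be a whole vertical line, fixed by `σ` up to finitely many points. With
the common zeros at `s` divided out of `S`, the fixed-point quadratic over `s` would vanish
identically, forcing the reduced matrix to vanish at `s`. -/
theorem finite_fibre {σ : dJo} {Γ : Set (ℂ × ℂ)} (hΓ : IsCurve Γ) (hfix : FixesCurve σ Γ)
    {S : Matrix (Fin 2) (Fin 2) ℂ[X]} (hS : S.det ≠ 0)
    (htr : S 1 1 = -S 0 0) (hf : IsFibreForm S (pullback σ y)) (s : ℂ) :
    {p ∈ Γ | p.1 = s}.Finite := by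
  obtain ⟨e, T, he, hT, hTs⟩ := exists_eval_ne_zero s S (by rintro rfl; simp at hS)
  have hSe : ∀ i j, S i j = e * T i j := fun i j => by rw [hT]; rfl
  have hfT : IsFibreForm T (pullback σ y) := by
    rw [IsFibreForm, hSe, hSe, hSe, hSe] at hf
    have he' : ofPoly e ≠ 0 := by rwa [Ne, ofPoly_eq_zero]
    apply mul_left_cancel₀ he'
    simp only [map_mul] at hf
    linear_combination hf
  have htrT : T 1 1 = -T 0 0 := by
    apply mul_left_cancel₀ he
    rw [← hSe, htr, hSe]
    ring
  obtain ⟨f, -, -, hΓf⟩ := hΓ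
  by_contra hinf
  have hline : ∀ t, (s, t) ∈ Γ := by
    have h1 : ∃ᶠ t in cofinite, (s, t) ∈ Γ := by
      intro h
      rw [eventually_cofinite] at h
      apply hinf
      refine (h.image fun t => (s, t)).subset ?_
      rintro ⟨s', t⟩ ⟨ht, rfl⟩
      exact ⟨t, by simpa using ht, rfl⟩
    have h2 : ∀ t, f.evalEval s t = (f.map (Polynomial.evalRingHom s)).eval t := by
      intro t
      rw [Polynomial.eval_map]
      exact (congrFun (Polynomial.eval₂_evalRingHom s ▸ rfl) _)
    have h3 : f.map (Polynomial.evalRingHom s) = 0 := by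
      apply eval_eq_zero_of_infinite
      refine h1.mono fun t ht => ?_
      rw [hΓf] at ht
      rw [← h2]
      exact ht
    intro t
    rw [hΓf]
    change f.evalEval s t = 0
    rw [h2, h3, Polynomial.eval_zero]
  have hall : ∀ᶠ t in cofinite, FixesAt T s t := by
    rw [eventually_cofinite]
    refine (hfix.image Prod.snd).subset ?_
    intro t ht
    refine ⟨(s, t), ⟨hline t, fun h => ht ?_⟩, rfl⟩
    exact hfT.eval_eq h.2
  have hq : Polynomial.C ((T 1 0).eval s) * Polynomial.X ^ 2 +
      Polynomial.C (-2 * (T 0 0).eval s) * Polynomial.X + Polynomial.C (-(T 0 1).eval s) = 0 := by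
    apply eval_eq_zero_of_infinite
    refine (hall.mono fun t ht => ?_).frequently
    rw [FixesAt, htrT, Polynomial.eval_neg] at ht
    simp only [Polynomial.eval_add, Polynomial.eval_mul, Polynomial.eval_C, Polynomial.eval_pow,
      Polynomial.eval_X]
    linear_combination ht
  have c2 := congrArg (fun p => Polynomial.coeff p 2) hq
  have c1 := congrArg (fun p => Polynomial.coeff p 1) hq
  have c0 := congrArg (fun p => Polynomial.coeff p 0) hq
  simp at c2
  simp [Polynomial.coeff_C, Polynomial.coeff_X_pow] at c1
  simp [Polynomial.coeff_X, Polynomial.coeff_C, Polynomial.coeff_X_pow] at c0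
  apply hTs
  ext i j
  fin_cases i <;> fin_cases j <;> simp [c0, c1, c2, htrT]

/-- `Γ` is, in general fibres, the fixed locus of the involution `σ`, which acts trivially on the
base and on the fibres by the traceless matrix `S`. -/
structure IsFixedLocus (σ : dJo) (S : Matrix (Fin 2) (Fin 2) ℂ[X]) (Γ : Set (ℂ × ℂ)) : Prop where
  base : pullback σ x = x
  det : S.det ≠ 0
  trace : S 1 1 = -S 0 0
  fibre : IsFibreForm S (pullback σ y)
  finite : ∀ s, {p ∈ Γ | p.1 = s}.Finite
  generic : ∀ᶠ s in cofinite, (S 1 0).eval s ≠ 0 ∧ (∀ t, (s, t) ∈ Γ ↔ FixesAt S s t) ∧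
      ∃ t₁ t₂, t₁ ≠ t₂ ∧ (s, t₁) ∈ Γ ∧ (s, t₂) ∈ Γ
  fixes : ∀ᶠ s in cofinite, ∀ t, (s, t) ∈ Γ → SendsPt σ (s, t) (s, t)

theorem exists_isFixedLocus {n : ℕ} {h : dJo} (hord : orderOf h = 2 * n) (hbase : HasBaseOrder h n)
    {Γ : Set (ℂ × ℂ)} (hcurve : IsCurve Γ) (hfix : FixesCurve (h ^ n) Γ) (hdeg : IsTwoToOne Γ) :
    ∃ S, IsFixedLocus (h ^ n) S Γ := by
  have hb : pullback (h ^ n : dJo) x = x := (hbase.2 n).2 dvd_rfl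
  have h2 : h ^ n * h ^ n = 1 := by rw [← pow_add, ← two_mul, ← hord, pow_orderOf_eq_one]
  have h1 : h ^ n ≠ 1 := by
    apply pow_ne_one_of_lt_orderOf hbase.1.ne'
    have := hbase.1
    omega
  obtain ⟨S, hS, htr, hf⟩ := exists_traceless_form hb h2 h1
  exact ⟨S, hb, hS, htr, hf, finite_fibre hcurve hfix hS htr hf,
    eventually_fixed_fibre hfix hdeg hS htr hf, Generically.eventually hfix⟩

/-! ### From conjugate elements to birational fixed curves. -/

/-- If `c` conjugates `σ₁` to `σ₂`, then it maps general points of the fixed curve of `σ₁` to the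
fixed curve of `σ₂`. -/
theorem IsFixedLocus.transport {σ₁ σ₂ c : dJo} {S₁ S₂ : Matrix (Fin 2) (Fin 2) ℂ[X]}
    {Γ₁ Γ₂ : Set (ℂ × ℂ)} (h₁ : IsFixedLocus σ₁ S₁ Γ₁) (h₂ : IsFixedLocus σ₂ S₂ Γ₂)
    (hc : c * σ₁ = σ₂ * c) :
    ∀ᶠ s in cofinite, ∀ t, (s, t) ∈ Γ₁ →
      ∃ q ∈ Γ₂, SendsPt c (s, t) q ∧ SendsPt c⁻¹ q (s, t) := by
  obtain ⟨A, M, hA⟩ := exists_hasForm c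
  set w := pullback c y with hw
  have hw0 : w ≠ 0 := fun h => y_ne_zero ((map_eq_zero (c : Bir).unop).1 h)
  set Z := pullback σ₁ w with hZ
  have hZ' : Z = pullback c (pullback σ₂ y) := by
    rw [hZ, hw, ← pullback_mul, ← pullback_mul, ← Subgroup.coe_mul, ← Subgroup.coe_mul, hc]
  have hZw : Z * (pullback c (ofPoly (S₂ 1 0)) * w + pullback c (ofPoly (S₂ 1 1))) =
      pullback c (ofPoly (S₂ 0 0)) * w + pullback c (ofPoly (S₂ 0 1)) := by
    have := congrArg (pullback c) h₂.fibre
    simpa only [pullback_mul_apply, pullback_add, ← hZ', ← hw] using this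
  filter_upwards [eventually_moebius hA.det_base h₂.generic, eventually_eval_ne_zero hA.det_fibre,
    h₁.fixes, eventually_sends_inv c] with s hs hdet hfix hinv t ht
  obtain ⟨hs0, hs1⟩ := hs
  set s' := (A 0 0 * s + A 0 1) / (A 1 0 * s + A 1 1) with hs'
  obtain ⟨hS10, hΓ, -⟩ := hs1 s' (div_mul_cancel₀ _ hs0)
  have hσ := hfix t ht
  have hu : ValueAt (s, t) (pullback c x) s' := hA.base.valueAt hs0
  have hpoly : ∀ r : ℂ[X], ValueAt (s, t) (pullback c (ofPoly r)) (r.eval s') := fun r =>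
    ValueAt.ofPoly_comp (φ := (c : Bir).unop) hu r
  by_cases hden : (M 1 0).eval s * t + (M 1 1).eval s = 0
  -- Here `c` would send `(s, t)` to infinity in its fibre. But `σ₂` sends infinity to the finite
  -- value `S₀₀ / S₁₀`, while `c σ₁ = σ₂ c` and `σ₁` fixes `(s, t)`. The contradiction is read off
  -- `Z · σ₁^*(w⁻¹) = 1`, whose left side takes the value `0`.
  · exfalso
    have hnum : (M 0 0).eval s * t + (M 0 1).eval s ≠ 0 := by
      intro h0
      apply hdet
      rw [Matrix.det_fin_two, Polynomial.eval_sub, Polynomial.eval_mul, Polynomial.eval_mul]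
      by_cases hc0 : (M 1 0).eval s = 0
      · have : (M 1 1).eval s = 0 := by simpa [hc0] using hden
        simp [hc0, this]
      · apply mul_left_cancel₀ hc0
        linear_combination (M 1 0).eval s * (M 0 0).eval s * hden -
          (M 1 0).eval s * (M 1 0).eval s * h0
    have hwinv : ValueAt (s, t) w⁻¹ 0 := by
      have h1 := valueAt_fibre_linear (s, t) (M 1 0) (M 1 1)
      have h2 := valueAt_fibre_linear (s, t) (M 0 0) (M 0 1)
      have h3 : w⁻¹ * (ofPoly (M 0 0) * y + ofPoly (M 0 1)) =
          ofPoly (M 1 0) * y + ofPoly (M 1 1) := by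
        rw [← show w * _ = _ from hA.fibre, inv_mul_cancel_left₀ hw0]
      rw [← h3] at h1
      have h4 := HasValue.of_mul h2 hnum h1
      rwa [show (M 1 0).eval (s, t).1 * (s, t).2 + (M 1 1).eval (s, t).1 = 0 from hden,
        zero_div] at h4
    have hZv : ValueAt (s, t) Z ((S₂ 0 0).eval s' / (S₂ 1 0).eval s') := by
      have h1 := (hpoly (S₂ 1 0)).add ((hpoly (S₂ 1 1)).mul hwinv)
      have h2 := (hpoly (S₂ 0 0)).add ((hpoly (S₂ 0 1)).mul hwinv)
      have h3 : Z * (pullback c (ofPoly (S₂ 1 0)) + pullback c (ofPoly (S₂ 1 1)) * w⁻¹) =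
          pullback c (ofPoly (S₂ 0 0)) + pullback c (ofPoly (S₂ 0 1)) * w⁻¹ := by
        apply mul_right_cancel₀ hw0
        rw [mul_assoc, add_mul, add_mul, inv_mul_cancel_right₀ hw0, inv_mul_cancel_right₀ hw0]
        exact hZw
      rw [← h3] at h2
      simp only [mul_zero, add_zero] at h1 h2
      exact HasValue.of_mul h1 hS10 h2
    have h1 := hZv.mul (hσ.comp hwinv)
    rw [hZ, ← pullback_mul_apply, mul_inv_cancel₀ hw0, pullback_one_apply, mul_zero] at h1
    have h2 := valueAt_const (s, t) 1
    rw [map_one] at h2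
    exact one_ne_zero (h2.unique h1)
  · set t' := ((M 0 0).eval s * t + (M 0 1).eval s) / ((M 1 0).eval s * t + (M 1 1).eval s)
    have hwv : ValueAt (s, t) w t' := hA.fibre.valueAt hden
    have hsend : SendsPt c (s, t) (s', t') := ⟨hu, hwv⟩
    refine ⟨(s', t'), (hΓ t').2 ?_, hsend, hinv _ _ hsend⟩
    have h1 := (hσ.comp hwv).mul (((hpoly (S₂ 1 0)).mul hwv).add (hpoly (S₂ 1 1)))
    rw [← hZ, hZw] at h1
    exact h1.unique (((hpoly (S₂ 0 0)).mul hwv).add (hpoly (S₂ 0 1)))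

/-- The homography `s ↦ (A₀₀ s + A₀₁) / (A₁₀ s + A₁₁)` of the line. -/
def homography (A : Matrix (Fin 2) (Fin 2) ℂ) : LineMap :=
  algebraMap ℂ[X] LineMap (lin (A 0 0) (A 0 1)) / algebraMap ℂ[X] LineMap (lin (A 1 0) (A 1 1))

theorem homography_sends {A : Matrix (Fin 2) (Fin 2) ℂ} (hA : A.det ≠ 0) {s s' : ℂ}
    (h : s' * (A 1 0 * s + A 1 1) = A 0 0 * s + A 0 1) : (homography A).Sends s s' := by
  have hden : A 1 0 * s + A 1 1 ≠ 0 := by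
    intro h0
    rw [h0, mul_zero] at h
    apply hA
    rw [Matrix.det_fin_two]
    by_cases hc : A 1 0 = 0
    · have : A 1 1 = 0 := by simpa [hc] using h0
      simp [hc, this]
    · apply mul_left_cancel₀ hc
      linear_combination A 1 0 * A 0 0 * h0 + A 1 0 * A 1 0 * h
  refine ⟨lin (A 0 0) (A 0 1), lin (A 1 0) (A 1 1), by simpa using hden, ?_, ?_⟩
  · refine div_mul_cancel₀ _ ?_
    rw [Ne, map_eq_zero_iff _ (IsFractionRing.injective ℂ[X] (FractionRing ℂ[X]))]
    intro h0
    have := congrArg (Polynomial.eval s) h0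
    rw [eval_lin, Polynomial.eval_zero] at this
    exact hden this
  · simp only [Polynomial.coe_evalRingHom, eval_lin]
    rw [eq_div_iff hden, h]

theorem generically_univ {P : ℂ → Prop} (h : ∀ᶠ s in cofinite, P s) : Generically Set.univ P := by
  rw [eventually_cofinite] at h
  exact h.subset fun s hs => hs.2

/-- Conjugate elements have conjugate restrictions to their fixed curves. -/
theorem exists_birational_of_conj {n : ℕ} {h₁ h₂ c : dJo} {S₁ S₂ : Matrix (Fin 2) (Fin 2) ℂ[X]}
    {Γ₁ Γ₂ : Set (ℂ × ℂ)} (hΓ₁ : IsFixedLocus (h₁ ^ n) S₁ Γ₁) (hΓ₂ : IsFixedLocus (h₂ ^ n) S₂ Γ₂)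
    (hc : c * h₁ = h₂ * c) :
    ∃ (ψ : PlaneMap) (α : LineMap), ψ.IsBirational Γ₁ Γ₂ ∧ α.IsBirational ∧ Covers ψ α Γ₁ ∧
      ConjugatesRestrictions ψ h₁ h₂ Γ₁ Γ₂ := by
  have hcn : c * h₁ ^ n = h₂ ^ n * c := ((show SemiconjBy c h₁ h₂ from hc).pow_right n)
  have hcn' : c⁻¹ * h₂ ^ n = h₁ ^ n * c⁻¹ := by
    rw [inv_mul_eq_iff_eq_mul, ← mul_assoc, hcn, mul_inv_cancel_right]
  have t₁ := hΓ₁.transport hΓ₂ hcn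
  have t₂ := hΓ₂.transport hΓ₁ hcn'
  rw [inv_inv] at t₂
  obtain ⟨A, M, hA⟩ := exists_hasForm c
  obtain ⟨B, N, hB⟩ := exists_hasForm c⁻¹
  refine ⟨toPlaneMap c, homography A, ⟨toPlaneMap c⁻¹, generically_of_eventually hΓ₁.finite t₁,
    generically_of_eventually hΓ₂.finite t₂⟩, ⟨homography B, generically_univ ?_,
    generically_univ ?_⟩, generically_of_eventually hΓ₁.finite ?_,
    generically_of_eventually hΓ₁.finite ?_⟩
  · filter_upwards [t₁, hΓ₁.generic] with s hs hg
    obtain ⟨t, -, -, ht, -⟩ := hg.2.2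
    obtain ⟨q, -, hq, hq'⟩ := hs t ht
    exact ⟨q.1, homography_sends hA.det_base (hA.base.eval_eq hq.1),
      homography_sends hB.det_base (hB.base.eval_eq hq'.1)⟩
  · filter_upwards [t₂, hΓ₂.generic] with s hs hg
    obtain ⟨t, -, -, ht, -⟩ := hg.2.2
    obtain ⟨q, -, hq, hq'⟩ := hs t ht
    exact ⟨q.1, homography_sends hB.det_base (hB.base.eval_eq hq.1),
      homography_sends hA.det_base (hA.base.eval_eq hq'.1)⟩
  · filter_upwards [t₁] with s hs t ht
    obtain ⟨q, -, hq, -⟩ := hs t ht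
    exact ⟨q, hq, homography_sends hA.det_base (hA.base.eval_eq hq.1)⟩
  -- Each `hᵢ` commutes with `hᵢ ^ n`, so transport applied to `hᵢ` itself shows that it preserves
  -- `Γᵢ`.
  · have u₁ := hΓ₁.transport hΓ₁ (Commute.self_pow h₁ n).eq
    have u₂ := hΓ₂.transport hΓ₂ (Commute.self_pow h₂ n).eq
    filter_upwards [t₁, u₁, eventually_sends c u₂, eventually_sends h₁ t₁] with s h1 h2 h3 h4 t ht
    obtain ⟨q, hqΓ, hq, -⟩ := h1 t ht
    obtain ⟨p', hpΓ, hp', -⟩ := h2 t ht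
    obtain ⟨q', hqΓ', hq', -⟩ := h3 t q hq q.2 hqΓ
    obtain ⟨q'', hqΓ'', hq'', -⟩ := h4 t p' hp' p'.2 hpΓ
    have e1 := hq.mul hq'
    have e2 := hp'.mul hq''
    rw [hc] at e2
    have := e2.unique e1
    subst this
    exact ⟨p', hpΓ, q, hqΓ, _, hqΓ', hp', hq'', hq, hq'⟩

/-! ### Birational maps of the line. -/

theorem eq_lin_of_natDegree_le {p : ℂ[X]} (h : p.natDegree ≤ 1) : p = lin (p.coeff 1) (p.coeff 0) :=
  Polynomial.eq_X_add_C_of_natDegree_le_one h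

/-- Birational maps of the line are homographies. -/
theorem LineMap.IsBirational.exists_homography {α : LineMap} (hα : α.IsBirational) :
    ∃ A : Matrix (Fin 2) (Fin 2) ℂ, A.det ≠ 0 ∧
      ∀ s t, α.Sends s t → t * (A 1 0 * s + A 1 1) = A 0 0 * s + A 0 1 := by
  obtain ⟨β, hβ, -⟩ := hα
  have hG : ∀ᶠ s in cofinite, ∃ t, α.Sends s t ∧ β.Sends t s := by
    rw [eventually_cofinite]
    simpa [Generically] using hβ
  obtain ⟨P, Q, hQ, hPQ, hαPQ, hden⟩ := exists_reduced ℂ[X] α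
  have hcop : IsCoprime P Q := hPQ.isCoprime
  have hval : ∀ s t, α.Sends s t → t * Q.eval s = P.eval s := fun s t h =>
    (HasValue.eval_eq h hαPQ).symm
  -- `P` and `Q` are independent over `ℂ`: otherwise `α` would be constant, and `β` could not
  -- recover two different points.
  have hind : ∀ u v : ℂ, Polynomial.C u * P + Polynomial.C v * Q = 0 → u = 0 ∧ v = 0 := by
    intro u v huv
    by_cases hu : u = 0
    · rw [hu, map_zero, zero_mul, zero_add] at huv
      exact ⟨hu, by simpa [hQ] using huv⟩
    · exfalso
      obtain ⟨s₀, t₀, h1, h2⟩ := hG.exists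
      have hne : ∀ᶠ s in cofinite, s ≠ s₀ := by
        rw [eventually_cofinite]
        simp
      obtain ⟨s₁, ⟨t₁, h3, h4⟩, h5⟩ := (hG.and hne).exists
      have hconst : ∀ s t, α.Sends s t → t = -v / u := by
        intro s t hst
        have e := congrArg (Polynomial.eval s) huv
        simp only [Polynomial.eval_add, Polynomial.eval_mul, Polynomial.eval_C,
          Polynomial.eval_zero, ← hval s t hst] at e
        have hQs : Q.eval s ≠ 0 := hden _ _ hst
        rw [eq_div_iff hu]
        apply mul_right_cancel₀ hQs
        linear_combination e
      rw [hconst _ _ h1] at h2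
      rw [hconst _ _ h3] at h4
      exact h5 (h4.unique h2)
  have hW : Polynomial.wronskian P Q ≠ 0 := by
    rw [Ne, hcop.wronskian_eq_zero_iff]
    rintro ⟨hP', hQ'⟩
    have eP := Polynomial.eq_C_of_derivative_eq_zero hP'
    have eQ := Polynomial.eq_C_of_derivative_eq_zero hQ'
    obtain ⟨h1, -⟩ := hind (Q.coeff 0) (-P.coeff 0) (by
      conv_lhs => rw [eP, eQ]
      simp
      ring)
    rw [eQ, h1, map_zero] at hQ
    exact hQ rfl
  -- A general `s` has `[P(s) : Q(s)]` different from `[P(b) : Q(b)]` at each of the finitely many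
  -- exceptional `b`; coprimality makes the latter meaningful.
  have hbad : ∀ᶠ s in cofinite, ∀ b ∈ {s | ¬ ∃ t, α.Sends s t ∧ β.Sends t s},
      P.eval s * Q.eval b - P.eval b * Q.eval s ≠ 0 := by
    rw [eventually_cofinite] at hG
    rw [hG.eventually_all]
    intro b _
    have hne : Polynomial.C (Q.eval b) * P + Polynomial.C (-P.eval b) * Q ≠ 0 := by
      intro h0
      obtain ⟨h1, h2⟩ := hind _ _ h0
      obtain ⟨u, v, huv⟩ := hcop
      have := congrArg (Polynomial.eval b) huv
      simp [h1, neg_eq_zero.1 h2] at this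
    filter_upwards [eventually_eval_ne_zero hne] with s hs h0
    apply hs
    simp only [Polynomial.eval_add, Polynomial.eval_mul, Polynomial.eval_C]
    linear_combination h0
  -- With `t = α(s)`, the root `s` of `P - t Q` is simple since the Wronskian does not vanish there.
  -- Any other root is either excluded by injectivity or exceptional and excluded by `hbad`. Two
  -- such values `t` then bound the degrees of both `P` and `Q` by one.
  have key : ∀ᶠ s in cofinite, ∃ t, α.Sends s t ∧ β.Sends t s ∧
      (P - Polynomial.C t * Q).natDegree ≤ 1 := by
    filter_upwards [hG, hbad, eventually_eval_ne_zero hW] with s hs hb hWs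
    obtain ⟨t, h1, h2⟩ := hs
    refine ⟨t, h1, h2, ?_⟩
    have hPs := hval s t h1
    have hQs : Q.eval s ≠ 0 := hden _ _ h1
    obtain ⟨g, hg⟩ : (Polynomial.X - Polynomial.C s) ∣ P - Polynomial.C t * Q := by
      rw [Polynomial.dvd_iff_isRoot, Polynomial.IsRoot]
      simp [hPs]
    have hgs : g.eval s ≠ 0 := by
      intro h0
      apply hWs
      have e := congrArg (fun p => (Polynomial.derivative p).eval s) hg
      simp [Polynomial.derivative_mul, h0] at e
      simp only [Polynomial.wronskian, Polynomial.eval_sub, Polynomial.eval_mul]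
      rw [← hPs]
      linear_combination -Q.eval s * e
    have hg0 : g.natDegree = 0 := by
      by_contra hdeg
      obtain ⟨z, hz⟩ := IsAlgClosed.exists_root g (fun h => hdeg (by
        rw [Polynomial.natDegree, h]; rfl))
      have e : P.eval z - t * Q.eval z = 0 := by
        have e := congrArg (Polynomial.eval z) hg
        rw [Polynomial.eval_mul, hz.eq_zero, mul_zero] at e
        simpa using e
      by_cases hzG : ∃ t, α.Sends z t ∧ β.Sends t z
      · obtain ⟨t', h3, h4⟩ := hzG
        have hQz : Q.eval z ≠ 0 := hden _ _ h3
        have : t' = t := by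
          apply mul_right_cancel₀ hQz
          rw [hval z t' h3]
          linear_combination e
        rw [this] at h4
        rw [h4.unique h2] at hz
        exact hgs hz
      · apply hb z hzG
        rw [← hPs]
        linear_combination -Q.eval s * e
    rw [hg]
    refine Polynomial.natDegree_mul_le.trans ?_
    rw [hg0, Polynomial.natDegree_X_sub_C]
  obtain ⟨s₀, t₀, h1, h2, h3⟩ := key.exists
  have hne : ∀ᶠ s in cofinite, s ≠ s₀ := by
    rw [eventually_cofinite]
    simp
  obtain ⟨s₁, ⟨t₁, h4, h5, h6⟩, h7⟩ := (key.and hne).exists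
  have ht : t₁ - t₀ ≠ 0 := by
    intro h
    rw [sub_eq_zero.1 h] at h5
    exact h7 (h5.unique h2)
  have hQ1 : Q.natDegree ≤ 1 := by
    have : Polynomial.C (t₁ - t₀) * Q =
        (P - Polynomial.C t₀ * Q) - (P - Polynomial.C t₁ * Q) := by
      rw [map_sub]; ring
    rw [← Polynomial.natDegree_C_mul ht, this]
    exact (Polynomial.natDegree_sub_le _ _).trans (max_le h3 h6)
  have hP1 : P.natDegree ≤ 1 := by
    have : P = (P - Polynomial.C t₀ * Q) + Polynomial.C t₀ * Q := by ring
    rw [this]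
    exact (Polynomial.natDegree_add_le _ _).trans
      (max_le h3 ((Polynomial.natDegree_C_mul_le _ _).trans hQ1))
  have eP := eq_lin_of_natDegree_le hP1
  have eQ := eq_lin_of_natDegree_le hQ1
  refine ⟨!![P.coeff 1, P.coeff 0; Q.coeff 1, Q.coeff 0], ?_, ?_⟩
  · rw [Matrix.det_fin_two_of]
    intro hdet
    have hd : Polynomial.C (P.coeff 1) * Polynomial.C (Q.coeff 0) =
        Polynomial.C (P.coeff 0) * Polynomial.C (Q.coeff 1) := by
      rw [← map_mul, ← map_mul, sub_eq_zero.1 hdet]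
    obtain ⟨c1, -⟩ := hind (Q.coeff 1) (-P.coeff 1) (by
      conv_lhs => rw [eP, eQ]
      simp [lin]
      linear_combination -hd)
    obtain ⟨c0, -⟩ := hind (Q.coeff 0) (-P.coeff 0) (by
      conv_lhs => rw [eP, eQ]
      simp [lin]
      linear_combination Polynomial.X * hd)
    rw [eQ, c0, c1] at hQ
    simp [lin] at hQ
  · intro s t hst
    have e := hval s t hst
    rw [eP, eQ] at e
    simpa using e

/-! ### Normal form of the action on the base. -/

theorem pullback_algebraMap (g : Bir) (c : ℂ) :
    pullback g (algebraMap ℂ FunctionField c) = algebraMap ℂ FunctionField c := g.unop.commutes c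

theorem pullback_div (g : Bir) (f f' : FunctionField) :
    pullback g (f / f') = pullback g f / pullback g f' := map_div₀ g.unop f f'

theorem pullback_eq_of_isMoebius {g : Bir} {u v : FunctionField} (h : IsMoebius ⊥ u v)
    (hu : pullback g u = u) : pullback g v = v := by
  obtain ⟨a, ha, b, hb, c, hc, d, hd, -, rfl⟩ := h
  rw [IntermediateField.mem_bot] at ha hb hc hd
  obtain ⟨a, rfl⟩ := ha
  obtain ⟨b, rfl⟩ := hb
  obtain ⟨c, rfl⟩ := hc
  obtain ⟨d, rfl⟩ := hd
  simp only [pullback_div, pullback_add, pullback_mul_apply, pullback_algebraMap, hu]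

theorem algebraMap_mem_bot (c : ℂ) :
    algebraMap ℂ FunctionField c ∈ (⊥ : IntermediateField ℂ FunctionField) :=
  IntermediateField.algebraMap_mem _ c

theorem pullback_pow_succ (h : dJo) (m : ℕ) (f : FunctionField) :
    pullback (h ^ (m + 1) : dJo) f = pullback h (pullback (h ^ m : dJo) f) := by
  rw [pow_succ, Subgroup.coe_mul, pullback_mul]

theorem pullback_pow_affine {h : dJo} {v : FunctionField} {b : ℂ}
    (hv : pullback h v = v + algebraMap ℂ FunctionField b) (m : ℕ) :
    pullback (h ^ m : dJo) v = v + algebraMap ℂ FunctionField (m * b) := by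
  induction m with
  | zero => simp [pullback]
  | succ m ih =>
    rw [pullback_pow_succ, ih, pullback_add, hv, pullback_algebraMap, Nat.cast_succ, add_mul,
      one_mul, map_add]
    ring

theorem pullback_pow_linear {h : dJo} {v : FunctionField} {a : ℂ}
    (hv : pullback h v = algebraMap ℂ FunctionField a * v) (m : ℕ) :
    pullback (h ^ m : dJo) v = algebraMap ℂ FunctionField (a ^ m) * v := by
  induction m with
  | zero => simp [pullback]
  | succ m ih =>
    rw [pullback_pow_succ, ih, pullback_mul_apply, hv, pullback_algebraMap, pow_succ, map_mul]
    ring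

/-- A homography is affine in the coordinate having its pole at a fixed point. -/
theorem one_div_sub_fixed_point {k : Type*} [Field k] {a b c d s u u' : k}
    (hu : u' * (c * u + d) = a * u + b) (hs : c * s ^ 2 + (d - a) * s - b = 0) (h : u - s ≠ 0)
    (h' : u' - s ≠ 0) (hac : a - c * s ≠ 0) :
    1 / (u' - s) = (c * s + d) / (a - c * s) * (1 / (u - s)) + c / (a - c * s) := by
  rw [div_mul_div_comm, mul_one, div_add_div _ _ (mul_ne_zero hac h) hac,
    div_eq_div_iff h' (mul_ne_zero (mul_ne_zero hac h) hac)]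
  linear_combination (a - c * s) * hs - (a - c * s) * hu

/-- Over `ℂ` a homography of the projective line has a fixed point; the coordinate `v` places it at
infinity. -/
theorem exists_affine_coordinate (h : dJo) : ∃ (v : FunctionField) (a b : ℂ),
    IsMoebius ⊥ x v ∧ pullback h v = algebraMap ℂ FunctionField a * v + algebraMap ℂ FunctionField b := by
  obtain ⟨A, hA, hu⟩ := exists_isBaseForm h.2.1
  rw [IsBaseForm, ofPoly_lin, ofPoly_lin] at hu
  rw [Matrix.det_fin_two] at hA
  by_cases hc : A 1 0 = 0
  · have hd : A 1 1 ≠ 0 := by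
      rintro hd
      simp [hc, hd] at hA
    refine ⟨x, A 0 0 / A 1 1, A 0 1 / A 1 1, IsMoebius.refl _ _, ?_⟩
    have hd' : algebraMap ℂ FunctionField (A 1 1) ≠ 0 := by simpa using hd
    rw [hc, map_zero, zero_mul, zero_add] at hu
    rw [map_div₀, map_div₀]
    field_simp
    linear_combination hu
  · obtain ⟨s, hs⟩ : ∃ s, A 1 0 * s ^ 2 + (A 1 1 - A 0 0) * s - A 0 1 = 0 := by
      obtain ⟨s, hs⟩ := IsAlgClosed.exists_root
        (Polynomial.C (A 1 0) * Polynomial.X ^ 2 + Polynomial.C (A 1 1 - A 0 0) * Polynomial.X +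
          Polynomial.C (-A 0 1)) (by rw [Polynomial.degree_quadratic hc]; decide)
      refine ⟨s, ?_⟩
      have := hs.eq_zero
      simp at this
      linear_combination this
    -- At a fixed point, `(a - c s)(c s + d) = a d - b c`.
    have hac : A 0 0 - A 1 0 * s ≠ 0 := by
      intro h0
      apply hA
      have : A 1 0 * (A 0 0 * A 1 1 - A 0 1 * A 1 0) = 0 := by
        linear_combination (A 1 0 * A 1 1 + A 1 0 * A 1 0 * s) * h0 + A 1 0 * A 1 0 * hs
      exact (mul_eq_zero.1 this).resolve_left hc
    have hxs : x - algebraMap ℂ FunctionField s ≠ 0 := fun h0 =>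
      x_notMem_bot (by rw [sub_eq_zero.1 h0]; exact algebraMap_mem_bot s)
    refine ⟨1 / (x - algebraMap ℂ FunctionField s), (A 1 0 * s + A 1 1) / (A 0 0 - A 1 0 * s),
      A 1 0 / (A 0 0 - A 1 0 * s), ⟨0, zero_mem _, 1, one_mem _, 1, one_mem _,
        -algebraMap ℂ FunctionField s, neg_mem (algebraMap_mem_bot s), by simp, ?_⟩, ?_⟩
    · rw [zero_mul, zero_add, one_mul, sub_eq_add_neg]
    · rw [pullback_div, pullback_one_apply, sub_eq_add_neg, pullback_add, ← map_neg,
        pullback_algebraMap, map_neg, ← sub_eq_add_neg, map_div₀, map_div₀]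
      have hac' : algebraMap ℂ FunctionField (A 0 0 - A 1 0 * s) ≠ 0 :=
        (map_ne_zero _).2 hac
      have hxs' : pullback h x - algebraMap ℂ FunctionField s ≠ 0 := by
        intro h0
        apply hxs
        have h1 : pullback h x = pullback h (algebraMap ℂ FunctionField s) := by
          rw [pullback_algebraMap]; exact sub_eq_zero.1 h0
        exact sub_eq_zero.2 ((h : Bir).unop.injective h1)
      have hs' := congrArg (algebraMap ℂ FunctionField) hs
      simp only [map_add, map_sub, map_mul, map_pow, map_zero] at hs'
      simp only [map_sub, map_mul, map_add] at hac' ⊢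
      exact one_div_sub_fixed_point hu hs' hxs hxs' hac'

/-- A translation of finite order is trivial in characteristic zero; an affine map with `a ≠ 1` has
a finite fixed point, which is moved to the origin. The order of the base action then makes the
multiplier a primitive root. -/
theorem exists_eigencoordinate {h : dJo} {n : ℕ} (hb : HasBaseOrder h n) :
    ∃ (u : FunctionField) (ζ : ℂ), IsMoebius ⊥ x u ∧ IsPrimitiveRoot ζ n ∧
      pullback h u = algebraMap ℂ FunctionField ζ * u := by
  obtain ⟨u, ζ, hu, hζ⟩ : ∃ (u : FunctionField) (ζ : ℂ), IsMoebius ⊥ x u ∧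
      pullback h u = algebraMap ℂ FunctionField ζ * u := by
    obtain ⟨v, a, b, hv, hav⟩ := exists_affine_coordinate h
    by_cases ha : a = 1
    · rw [ha, map_one, one_mul] at hav
      have h1 := pullback_pow_affine hav n
      rw [pullback_eq_of_isMoebius hv ((hb.2 n).2 dvd_rfl), left_eq_add, map_eq_zero, mul_eq_zero,
        Nat.cast_eq_zero] at h1
      rw [h1.resolve_left hb.1.ne'] at hav
      exact ⟨v, 1, hv, by rw [hav]; simp⟩
    · have ha' : a - 1 ≠ 0 := sub_ne_zero.2 ha
      refine ⟨v + algebraMap ℂ FunctionField (b / (a - 1)), a,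
        hv.trans x_notMem_bot ⟨1, one_mem _, _, algebraMap_mem_bot (b / (a - 1)), 0, zero_mem _, 1,
          one_mem _, by simp, by simp⟩, ?_⟩
      rw [pullback_add, pullback_algebraMap, hav, mul_add, ← map_mul, add_assoc, ← map_add]
      congr 2
      field_simp
      ring
  refine ⟨u, ζ, hu, ?_, hζ⟩
  have hu0 : u ≠ 0 := by
    rintro rfl
    exact hu.notMem x_notMem_bot (zero_mem _)
  have key : ∀ m : ℕ, ζ ^ m = 1 ↔ n ∣ m := by
    intro m
    rw [← hb.2 m]
    have h1 := pullback_pow_linear hζ m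
    constructor
    · intro h2
      rw [h2, map_one, one_mul] at h1
      exact pullback_eq_of_isMoebius (hu.symm x_notMem_bot) h1
    · intro h2
      rw [pullback_eq_of_isMoebius hu h2] at h1
      have h3 : algebraMap ℂ FunctionField (ζ ^ m) = algebraMap ℂ FunctionField 1 := by
        rw [map_one]
        exact mul_right_cancel₀ hu0 (by rw [← h1, one_mul])
      exact (algebraMap ℂ FunctionField).injective h3
  exact ⟨(key n).2 dvd_rfl, fun m hm => (key m).1 hm⟩

/-! ### Semilinear maps and Hilbert 90. -/

section Semilinear

variable {K : Type*} [Field K]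

/-- If a combination of `2 × 2` matrices is invertible, so is one of the matrices or the sum of two
of them. -/
theorem exists_det_add_ne_zero {ι : Type*} (s : Finset ι) (Q : ι → Matrix (Fin 2) (Fin 2) K)
    (d : ι → K) (h : (∑ j ∈ s, d j • Q j).det ≠ 0) :
    (∃ j ∈ s, (Q j).det ≠ 0) ∨ ∃ j ∈ s, ∃ k ∈ s, (Q j + Q k).det ≠ 0 := by
  classical
  by_contra! hcon
  obtain ⟨h1, h2⟩ := hcon
  -- The polar form of the determinant: if this quadratic form vanishes at all `Q j` and `Q j + Q
  -- k`, it vanishes on their span.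
  let B : Matrix (Fin 2) (Fin 2) K → Matrix (Fin 2) (Fin 2) K → K := fun P R =>
    P 0 0 * R 1 1 + P 1 1 * R 0 0 - P 0 1 * R 1 0 - P 1 0 * R 0 1
  have hdet : ∀ P R, (P + R).det = P.det + R.det + B P R := by
    intro P R
    simp only [Matrix.det_fin_two, Matrix.add_apply, B]
    ring
  have hB : ∀ j ∈ s, ∀ k ∈ s, B (Q j) (Q k) = 0 := by
    intro j hj k hk
    have := h2 j hj k hk
    rwa [hdet, h1 j hj, h1 k hk, zero_add, zero_add] at this
  have key : ∀ u ⊆ s, (∑ j ∈ u, d j • Q j).det = 0 ∧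
      ∀ k ∈ s, B (∑ j ∈ u, d j • Q j) (Q k) = 0 := by
    intro u
    induction u using Finset.induction_on with
    | empty => exact fun _ => ⟨by simp, fun k _ => by simp [B]⟩
    | insert a u ha ih =>
      intro hu
      have has : a ∈ s := hu (Finset.mem_insert_self a u)
      obtain ⟨i1, i2⟩ := ih fun z hz => hu (Finset.mem_insert_of_mem hz)
      rw [Finset.sum_insert ha, add_comm]
      refine ⟨?_, fun k hk => ?_⟩
      · have e := i2 a has
        rw [hdet, i1, Matrix.det_smul, h1 a has]
        simp only [B, Matrix.smul_apply, smul_eq_mul] at e ⊢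
        linear_combination d a * e
      · have e := i2 k hk
        have e' := hB a has k hk
        simp only [B, Matrix.add_apply, Matrix.smul_apply, smul_eq_mul] at e e' ⊢
        linear_combination e + d a * e'
  exact h (key s subset_rfl).1

variable (θ : K →+* K)

/-- The matrix of the `k`-th power of the semilinear map given by `M` and `θ`. -/
def cocycle (M : Matrix (Fin 2) (Fin 2) K) : ℕ → Matrix (Fin 2) (Fin 2) K
  | 0 => 1
  | k + 1 => (cocycle M k).map θ * M

variable {θ}

/-- When `θ ^ n = 1`, the two recursions at `k = n` show that the `n`-th power commutes with the
semilinear map. -/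
theorem cocycle_succ' (M : Matrix (Fin 2) (Fin 2) K) (k : ℕ) :
    cocycle θ M (k + 1) = M.map (θ ^ k) * cocycle θ M k := by
  induction k with
  | zero =>
    ext i j
    simp [cocycle]
  | succ k ih =>
    conv_lhs => rw [cocycle, ih, Matrix.map_mul, mul_assoc, ← cocycle, Matrix.map_map]
    rw [pow_succ']
    rfl

theorem det_map_ne_zero {M : Matrix (Fin 2) (Fin 2) K} (hM : M.det ≠ 0) : (M.map θ).det ≠ 0 := by
  rw [← RingHom.mapMatrix_apply, ← RingHom.map_det]
  exact (map_ne_zero θ).2 hM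

theorem det_cocycle_ne_zero {M : Matrix (Fin 2) (Fin 2) K} (hM : M.det ≠ 0) (k : ℕ) :
    (cocycle θ M k).det ≠ 0 := by
  induction k with
  | zero => simp [cocycle]
  | succ k ih =>
    rw [cocycle, Matrix.det_mul]
    exact mul_ne_zero (det_map_ne_zero ih) hM

/-- Rescaling `M` multiplies its `n`-th power by a norm; this is the freedom used to equalise two
such powers. -/
theorem cocycle_smul (M : Matrix (Fin 2) (Fin 2) K) (m : K) (k : ℕ) :
    cocycle θ (m • M) k = (∏ j ∈ Finset.range k, (θ ^ j) m) • cocycle θ M k := by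
  induction k with
  | zero => simp [cocycle]
  | succ k ih =>
    rw [cocycle, ih, cocycle, Finset.prod_range_succ', pow_zero]
    have : ((∏ j ∈ Finset.range k, (θ ^ j) m) • cocycle θ M k).map θ =
        (∏ j ∈ Finset.range k, (θ ^ (j + 1)) m) • (cocycle θ M k).map θ := by
      ext i j
      simp only [Matrix.map_apply, Matrix.smul_apply, smul_eq_mul, map_mul, map_prod]
      congr 1
      refine Finset.prod_congr rfl fun l _ => ?_
      rw [pow_succ']
      rfl
    rw [this, smul_mul_smul_comm]
    rfl

/-- Two semilinear maps with the same `n`-th power are conjugate by an invertible matrix, provided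
that `θ` has enough independent powers. -/
theorem exists_intertwiner {n : ℕ} (hθ : θ ^ n = 1) {M₁ M₂ : Matrix (Fin 2) (Fin 2) K}
    (hM₁ : M₁.det ≠ 0) (hM₂ : M₂.det ≠ 0) (h : cocycle θ M₁ n = cocycle θ M₂ n)
    {ι : Type*} (s : Finset ι) (c d : ι → K) {e : K} (he : e ≠ 0)
    (hcd : ∀ i < n, ∑ j ∈ s, d j * (θ ^ i) (c j) = if i = 0 then e else 0) (hn : 0 < n) :
    ∃ P : Matrix (Fin 2) (Fin 2) K, P.det ≠ 0 ∧ P.map θ * M₂ = M₁ * P := by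
  -- Any intertwiner satisfies `θ^i(P) = A₁ᵢ P A₂ᵢ⁻¹`, so averaging `A₁ᵢ⁻¹ θ^i(a) A₂ᵢ` should
  -- produce one. Equality of the `n`-th powers makes `B` return to `1`, closing the cyclic sum.
  let B : ℕ → Matrix (Fin 2) (Fin 2) K := fun i => (cocycle θ M₁ i)⁻¹ * cocycle θ M₂ i
  have hAB : ∀ i, cocycle θ M₁ i * B i = cocycle θ M₂ i := fun i =>
    Matrix.mul_nonsing_inv_cancel_left _ _ (det_cocycle_ne_zero hM₁ i).isUnit
  have hB0 : B 0 = 1 := by simp [B, cocycle]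
  have hBn : B n = 1 := by
    simp only [B, h]
    exact Matrix.nonsing_inv_mul _ (det_cocycle_ne_zero hM₂ n).isUnit
  have hB : ∀ i, (B i).map θ * M₂ = M₁ * B (i + 1) := by
    intro i
    have hu : IsUnit ((cocycle θ M₁ i).map θ) :=
      (Matrix.isUnit_iff_isUnit_det _).2 (det_map_ne_zero (det_cocycle_ne_zero hM₁ i)).isUnit
    apply hu.mul_left_cancel
    rw [← mul_assoc, ← mul_assoc, ← Matrix.map_mul, hAB]
    change cocycle θ M₂ (i + 1) = cocycle θ M₁ (i + 1) * B (i + 1)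
    rw [hAB]
  let P : K → Matrix (Fin 2) (Fin 2) K := fun a => ∑ i ∈ Finset.range n, (θ ^ i) a • B i
  have hP : ∀ a, (P a).map θ * M₂ = M₁ * P a := by
    intro a
    have h1 : (P a).map θ = ∑ i ∈ Finset.range n, (θ ^ (i + 1)) a • (B i).map θ := by
      ext k l
      simp only [P, Matrix.map_apply, Matrix.sum_apply, Matrix.smul_apply, smul_eq_mul, map_sum,
        map_mul]
      refine Finset.sum_congr rfl fun i _ => ?_
      rw [pow_succ']
      rfl
    have h2 : ∑ i ∈ Finset.range n, (θ ^ (i + 1)) a • B (i + 1) = P a := by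
      have e1 := Finset.sum_range_succ' (fun i => (θ ^ i) a • B i) n
      rw [Finset.sum_range_succ] at e1
      rw [hB0, hBn, hθ, pow_zero] at e1
      exact (add_right_cancel e1).symm
    rw [h1, Finset.sum_mul, ← h2, Finset.mul_sum]
    refine Finset.sum_congr rfl fun i _ => ?_
    rw [smul_mul_assoc, hB, mul_smul_comm]
  have hPadd : ∀ a b, P (a + b) = P a + P b := by
    intro a b
    simp only [P, map_add, add_smul, Finset.sum_add_distrib]
  -- The orthogonality relations isolate the term `B 0 = 1`, so an invertible matrix lies in the
  -- span of the `P (c j)`; as `P` is additive, some `P (c j)` or `P (c j + c k)` is then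
  -- invertible.
  have hsum : ∑ j ∈ s, d j • P (c j) = e • (1 : Matrix (Fin 2) (Fin 2) K) := by
    simp only [P, Finset.smul_sum, smul_smul]
    rw [Finset.sum_comm]
    simp only [← Finset.sum_smul]
    rw [Finset.sum_eq_single_of_mem 0 (Finset.mem_range.2 hn), hcd 0 hn, if_pos rfl, hB0]
    intro i hi hi0
    rw [hcd i (Finset.mem_range.1 hi), if_neg hi0, zero_smul]
  rcases exists_det_add_ne_zero s (fun j => P (c j)) d (by
    rw [hsum, Matrix.det_smul]
    simpa using he) with ⟨j, -, hj⟩ | ⟨j, -, k, -, hjk⟩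
  · exact ⟨_, hj, hP _⟩
  · rw [← hPadd] at hjk
    exact ⟨_, hjk, hP _⟩

end Semilinear

/-! ### Norms in the cyclic extension `ℂ(X) / ℂ(Xⁿ)`. -/

section Norm

/-- `θ` is the automorphism `f(X) ↦ f(ζ X)` of `ℂ(X)`. -/
def IsScaling (ζ : ℂ) (θ : LineMap →+* LineMap) : Prop :=
  ∀ p : ℂ[X], θ (algebraMap ℂ[X] LineMap p) =
    algebraMap ℂ[X] LineMap (p.comp (Polynomial.C ζ * Polynomial.X))

theorem exists_scaling {ζ : ℂ} (hζ : ζ ≠ 0) : ∃ θ, IsScaling ζ θ := by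
  let g : ℂ[X] →+* LineMap :=
    (algebraMap ℂ[X] LineMap).comp (Polynomial.compRingHom (Polynomial.C ζ * Polynomial.X))
  have hg : Function.Injective g := by
    refine (IsFractionRing.injective ℂ[X] LineMap).comp ?_
    refine Function.LeftInverse.injective
      (g := fun p => p.comp (Polynomial.C ζ⁻¹ * Polynomial.X)) fun p => ?_
    have h1 : (Polynomial.C ζ * Polynomial.X).comp (Polynomial.C ζ⁻¹ * Polynomial.X) =
        Polynomial.X := by
      rw [Polynomial.mul_comp, Polynomial.C_comp, Polynomial.X_comp, ← mul_assoc, ← map_mul,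
        mul_inv_cancel₀ hζ, map_one, one_mul]
    change (p.comp _).comp _ = p
    rw [Polynomial.comp_assoc, h1, Polynomial.comp_X]
  exact ⟨IsFractionRing.lift hg, fun p => IsFractionRing.lift_algebraMap hg p⟩

variable {ζ : ℂ} {θ : LineMap →+* LineMap}

theorem IsScaling.pow (hθ : IsScaling ζ θ) (i : ℕ) : IsScaling (ζ ^ i) (θ ^ i) := by
  induction i with
  | zero => intro p; simp
  | succ i ih =>
    intro p
    rw [pow_succ', RingHom.mul_def, RingHom.comp_apply, ih, hθ, Polynomial.comp_assoc]
    congr 2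
    rw [Polynomial.mul_comp, Polynomial.C_comp, Polynomial.X_comp, ← mul_assoc, ← map_mul, pow_succ]

theorem lineMap_hom_ext {L : Type*} [Field L] {f g : LineMap →+* L}
    (h : ∀ p : ℂ[X], f (algebraMap ℂ[X] LineMap p) = g (algebraMap ℂ[X] LineMap p)) : f = g := by
  ext z
  obtain ⟨a, b, -, rfl⟩ := IsFractionRing.div_surjective (A := ℂ[X]) z
  rw [map_div₀, map_div₀, h, h]

theorem IsScaling.pow_eq_one (hθ : IsScaling ζ θ) {n : ℕ} (hζ : ζ ^ n = 1) : θ ^ n = 1 := by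
  refine lineMap_hom_ext fun p => ?_
  rw [hθ.pow, hζ]
  simp

theorem IsScaling.pow_X_pow (hθ : IsScaling ζ θ) (i j : ℕ) :
    (θ ^ i) (algebraMap ℂ[X] LineMap Polynomial.X ^ j) =
      algebraMap ℂ[X] LineMap (Polynomial.C ((ζ ^ i) ^ j)) *
        algebraMap ℂ[X] LineMap Polynomial.X ^ j := by
  rw [map_pow, hθ.pow, Polynomial.X_comp, map_mul, mul_pow, ← map_pow, ← map_pow]

theorem algebraMap_X_ne_zero : algebraMap ℂ[X] LineMap Polynomial.X ≠ 0 := by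
  rw [Ne, map_eq_zero_iff _ (IsFractionRing.injective ℂ[X] LineMap)]
  exact Polynomial.X_ne_zero

/-- Since `θ^i` multiplies `X^j` by `ζ^(i j)`, this is a character sum over the `n`-th roots of
unity. It supplies the orthogonality needed by `exists_intertwiner`. -/
theorem IsScaling.independent (hθ : IsScaling ζ θ) {n : ℕ} (hζ : IsPrimitiveRoot ζ n) {i : ℕ}
    (hi : i < n) :
    ∑ j ∈ Finset.range n, (algebraMap ℂ[X] LineMap Polynomial.X ^ j)⁻¹ *
      (θ ^ i) (algebraMap ℂ[X] LineMap Polynomial.X ^ j) = if i = 0 then (n : LineMap) else 0 := by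
  have h1 : ∀ j, (algebraMap ℂ[X] LineMap Polynomial.X ^ j)⁻¹ *
      (θ ^ i) (algebraMap ℂ[X] LineMap Polynomial.X ^ j) =
        algebraMap ℂ[X] LineMap (Polynomial.C ((ζ ^ i) ^ j)) := by
    intro j
    rw [hθ.pow_X_pow, mul_comm, mul_inv_cancel_right₀ (pow_ne_zero _ algebraMap_X_ne_zero)]
  simp only [h1]
  rw [← map_sum, ← map_sum]
  split_ifs with h0
  · simp [h0]
  · have h2 : ζ ^ i ≠ 1 := hζ.pow_ne_one_of_pos_of_lt h0 hi
    have h3 : ∑ j ∈ Finset.range n, (ζ ^ i) ^ j = 0 := by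
      rw [geom_sum_eq h2, ← pow_mul, mul_comm, pow_mul, hζ.pow_eq_one, one_pow, sub_self, zero_div]
    rw [h3, map_zero, map_zero]

/-- The norm to the invariants of the cyclic group of order `n` generated by `θ`. -/
def cyclicNorm (θ : LineMap →+* LineMap) (n : ℕ) : LineMap →* LineMap where
  toFun m := ∏ i ∈ Finset.range n, (θ ^ i) m
  map_one' := by simp
  map_mul' a b := by simp [Finset.prod_mul_distrib]

theorem cyclicNorm_apply (n : ℕ) (m : LineMap) :
    cyclicNorm θ n m = ∏ i ∈ Finset.range n, (θ ^ i) m := rfl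

theorem const_mem_range_cyclicNorm (hθ : IsScaling ζ θ) {n : ℕ} (hn : 0 < n) (c : ℂ) :
    algebraMap ℂ[X] LineMap (Polynomial.C c) ∈ MonoidHom.mrange (cyclicNorm θ n) := by
  obtain ⟨d, hd⟩ := IsAlgClosed.exists_pow_nat_eq c hn
  refine ⟨algebraMap ℂ[X] LineMap (Polynomial.C d), ?_⟩
  rw [cyclicNorm_apply, Finset.prod_congr rfl fun i _ => hθ.pow i _]
  simp [← hd]

/-- With `ρⁿ = r`, the norm of `ρ - X` is `∏ (ρ - ζ^i X) = r - Xⁿ`; the sign is a constant, hence an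
`n`-th power and a norm. -/
theorem X_pow_sub_mem_range_cyclicNorm (hθ : IsScaling ζ θ) {n : ℕ} (hn : 0 < n)
    (hζ : IsPrimitiveRoot ζ n) (r : ℂ) :
    algebraMap ℂ[X] LineMap (Polynomial.X ^ n - Polynomial.C r) ∈
      MonoidHom.mrange (cyclicNorm θ n) := by
  obtain ⟨ρ, hρ⟩ := IsAlgClosed.exists_pow_nat_eq r hn
  have h1 : algebraMap ℂ[X] LineMap (Polynomial.C r - Polynomial.X ^ n) ∈
      MonoidHom.mrange (cyclicNorm θ n) := by
    refine ⟨algebraMap ℂ[X] LineMap (Polynomial.C ρ - Polynomial.X), ?_⟩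
    rw [cyclicNorm_apply, Finset.prod_congr rfl fun i _ => hθ.pow i _, ← map_prod]
    congr 1
    have hζ' : IsPrimitiveRoot (Polynomial.C ζ) n :=
      hζ.map_of_injective Polynomial.C_injective
    rw [← hρ, map_pow, hζ'.pow_sub_pow_eq_prod_sub_mul _ _ hn]
    have : NeZero n := ⟨hn.ne'⟩
    refine Finset.prod_bij (fun i _ => Polynomial.C ζ ^ i) ?_ ?_ ?_ ?_
    · intro i _
      rw [Polynomial.mem_nthRootsFinset hn, ← pow_mul, mul_comm, pow_mul, hζ'.pow_eq_one, one_pow]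
    · intro i hi j hj h
      exact hζ'.pow_inj (Finset.mem_range.1 hi) (Finset.mem_range.1 hj) h
    · intro ω hω
      obtain ⟨i, hi, h⟩ := hζ'.eq_pow_of_pow_eq_one ((Polynomial.mem_nthRootsFinset hn _).1 hω)
      exact ⟨i, Finset.mem_range.2 hi, h⟩
    · intro i _
      simp
  have h2 := mul_mem (const_mem_range_cyclicNorm hθ hn (-1)) h1
  rw [← map_mul] at h2
  convert h2 using 2
  simp

theorem expand_mem_range_cyclicNorm (hθ : IsScaling ζ θ) {n : ℕ} (hn : 0 < n)
    (hζ : IsPrimitiveRoot ζ n) (Q : ℂ[X]) :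
    algebraMap ℂ[X] LineMap (Polynomial.expand ℂ n Q) ∈ MonoidHom.mrange (cyclicNorm θ n) := by
  rw [(IsAlgClosed.splits Q).eq_prod_roots, map_mul, map_mul, Polynomial.expand_C, map_multiset_prod,
    map_multiset_prod, Multiset.map_map, Multiset.map_map]
  refine mul_mem (const_mem_range_cyclicNorm hθ hn _) (multiset_prod_mem _ ?_)
  intro z hz
  obtain ⟨r, -, rfl⟩ := Multiset.mem_map.1 hz
  have := X_pow_sub_mem_range_cyclicNorm hθ hn hζ r
  simpa using this

theorem map_cyclicNorm {n : ℕ} (hn : θ ^ n = 1) (m : LineMap) :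
    θ (cyclicNorm θ n m) = cyclicNorm θ n m := by
  have h1 := Finset.prod_range_succ' (fun i => (θ ^ i) m) n
  rw [Finset.prod_range_succ, hn, pow_zero] at h1
  by_cases hm : m = 0
  · by_cases h0 : n = 0
    · simp [cyclicNorm_apply, h0]
    · simp [cyclicNorm_apply, hm, h0]
  · have h2 := mul_right_cancel₀ (b := m) hm h1
    rw [cyclicNorm_apply, map_prod]
    refine Eq.trans (Finset.prod_congr rfl fun i _ => ?_) h2.symm
    rw [pow_succ']
    rfl

/-- In the cyclic extension `ℂ(X) / ℂ(Xⁿ)` every non-zero invariant function is a norm. -/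
theorem exists_cyclicNorm_eq (hθ : IsScaling ζ θ) {n : ℕ} (hn : 0 < n)
    (hζ : IsPrimitiveRoot ζ n) {k : LineMap} (hk : θ k = k) (hk0 : k ≠ 0) :
    ∃ m ≠ 0, ∏ i ∈ Finset.range n, (θ ^ i) m = k := by
  obtain ⟨p, q, hq, rfl⟩ := IsFractionRing.div_surjective (A := ℂ[X]) k
  set k := algebraMap ℂ[X] LineMap p / algebraMap ℂ[X] LineMap q with hkdef
  set q' := algebraMap ℂ[X] LineMap q with hq'
  have hq0 : q' ≠ 0 := by
    rw [hq', Ne, map_eq_zero_iff _ (IsFractionRing.injective ℂ[X] LineMap)]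
    exact nonZeroDivisors.ne_zero hq
  have hN0 : cyclicNorm θ n q' ≠ 0 := by
    rw [cyclicNorm_apply, Finset.prod_ne_zero_iff]
    exact fun i _ => (map_ne_zero _).2 hq0
  -- Multiplying by the norm of the denominator changes `k` by a norm, keeps it invariant and makes
  -- it a polynomial: the other conjugates of `q` go into the numerator.
  obtain ⟨P, hP⟩ : ∃ P, algebraMap ℂ[X] LineMap P = k * cyclicNorm θ n q' := by
    obtain ⟨l, rfl⟩ := Nat.exists_eq_succ_of_ne_zero hn.ne'
    refine ⟨p * ∏ i ∈ Finset.range l,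
      q.comp (Polynomial.C (ζ ^ (i + 1)) * Polynomial.X), ?_⟩
    rw [cyclicNorm_apply, Finset.prod_range_succ', map_mul, map_prod,
      Finset.prod_congr rfl fun i _ => (hθ.pow (i + 1) q).symm, hkdef, pow_zero, RingHom.coe_one, id,
      ← hq']
    field_simp
  have hPθ : P.comp (Polynomial.C ζ * Polynomial.X) = P := by
    apply IsFractionRing.injective ℂ[X] LineMap
    rw [← hθ P, hP, map_mul, hk, map_cyclicNorm (hθ.pow_eq_one hζ.pow_eq_one)]
  -- Invariance under `X ↦ ζ X` kills every coefficient whose exponent is not a multiple of `n`.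
  have hPe : Polynomial.expand ℂ n (Polynomial.contract n P) = P := by
    ext i
    rw [Polynomial.coeff_expand hn]
    split_ifs with hi
    · rw [Polynomial.coeff_contract hn.ne', Nat.div_mul_cancel hi]
    · have e := congrArg (fun p => Polynomial.coeff p i) hPθ
      rw [Polynomial.comp_C_mul_X_coeff] at e
      have h1 : ζ ^ i - 1 ≠ 0 := fun h => hi ((hζ.pow_eq_one_iff_dvd i).1 (sub_eq_zero.1 h))
      symm
      apply (mul_eq_zero.1 (_ : P.coeff i * (ζ ^ i - 1) = 0)).resolve_right h1
      linear_combination e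
  obtain ⟨m, hm⟩ := expand_mem_range_cyclicNorm hθ hn hζ (Polynomial.contract n P)
  rw [hPe, hP] at hm
  have hmk : cyclicNorm θ n (m / q') = k := by
    apply mul_right_cancel₀ hN0
    rw [← map_mul, div_mul_cancel₀ _ hq0, hm]
  refine ⟨m / q', ?_, hmk⟩
  intro h0
  rw [h0, cyclicNorm_apply] at hmk
  apply hk0
  rw [← hmk]
  simp [hn.ne']

end Norm

/-! ### Homographies over `ℂ(x)` acting on `y`. -/

/-- The embedding of `ℂ(x)` in `ℂ(x, y)`. -/
def baseEmb : LineMap →+* FunctionField := IsFractionRing.lift ofPoly_injective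

@[simp] theorem baseEmb_algebraMap (p : ℂ[X]) : baseEmb (algebraMap ℂ[X] LineMap p) = ofPoly p :=
  IsFractionRing.lift_algebraMap ofPoly_injective p

theorem baseEmb_mem (k : LineMap) : baseEmb k ∈ ℂ⟮x⟯ := by
  obtain ⟨a, b, -, rfl⟩ := IsFractionRing.div_surjective (A := ℂ[X]) k
  rw [map_div₀, baseEmb_algebraMap, baseEmb_algebraMap]
  exact div_mem (ofPoly_mem a) (ofPoly_mem b)

theorem pullback_baseEmb {h : dJo} {ζ : ℂ} (hx : pullback h x = algebraMap ℂ FunctionField ζ * x)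
    {θ : LineMap →+* LineMap} (hθ : IsScaling ζ θ) (k : LineMap) :
    pullback h (baseEmb k) = baseEmb (θ k) := by
  have : ((h : Bir).unop : FunctionField →+* FunctionField).comp baseEmb = baseEmb.comp θ := by
    refine lineMap_hom_ext fun p => ?_
    simp only [RingHom.comp_apply, hθ p, baseEmb_algebraMap]
    rw [ofPoly_eq_aeval, ofPoly_eq_aeval, Polynomial.aeval_comp]
    have := Polynomial.aeval_algHom_apply ((h : Bir).unop : FunctionField →ₐ[ℂ] FunctionField) x p
    refine this.symm.trans (congrArg (fun z => Polynomial.aeval z p) ?_)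
    rw [map_mul, Polynomial.aeval_C, Polynomial.aeval_X]
    exact hx
  exact congrArg (fun f => f k) this

theorem baseEmb_quadratic_eq_zero {a b c : LineMap}
    (h : baseEmb a * y ^ 2 + baseEmb b * y + baseEmb c = 0) : a = 0 ∧ b = 0 ∧ c = 0 := by
  obtain ⟨p₁, q₁, hq₁, rfl⟩ := IsFractionRing.div_surjective (A := ℂ[X]) a
  obtain ⟨p₂, q₂, hq₂, rfl⟩ := IsFractionRing.div_surjective (A := ℂ[X]) b
  obtain ⟨p₃, q₃, hq₃, rfl⟩ := IsFractionRing.div_surjective (A := ℂ[X]) c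
  have hq₁ := nonZeroDivisors.ne_zero hq₁
  have hq₂ := nonZeroDivisors.ne_zero hq₂
  have hq₃ := nonZeroDivisors.ne_zero hq₃
  simp only [map_div₀, baseEmb_algebraMap] at h
  have n₁ : ofPoly q₁ ≠ 0 := by rwa [Ne, ofPoly_eq_zero]
  have n₂ : ofPoly q₂ ≠ 0 := by rwa [Ne, ofPoly_eq_zero]
  have n₃ : ofPoly q₃ ≠ 0 := by rwa [Ne, ofPoly_eq_zero]
  have h' : ofPoly (p₁ * q₂ * q₃) * y ^ 2 + ofPoly (p₂ * q₁ * q₃) * y +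
      ofPoly (p₃ * q₁ * q₂) = 0 := by
    simp only [map_mul]
    field_simp at h
    linear_combination h
  obtain ⟨e₁, e₂, e₃⟩ := ofPoly_quadratic_eq_zero h'
  have e₁ : p₁ = 0 := by simpa [hq₂, hq₃] using e₁
  have e₂ : p₂ = 0 := by simpa [hq₁, hq₃] using e₂
  have e₃ : p₃ = 0 := by simpa [hq₁, hq₂] using e₃
  simp [e₁, e₂, e₃]

/-- The image of `y` under the homography with matrix `M` over `ℂ(x)`. -/
def mob (M : Matrix (Fin 2) (Fin 2) LineMap) : FunctionField :=
  (baseEmb (M 0 0) * y + baseEmb (M 0 1)) / (baseEmb (M 1 0) * y + baseEmb (M 1 1))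

theorem mob_denom_ne_zero {M : Matrix (Fin 2) (Fin 2) LineMap} (hM : M.det ≠ 0) :
    baseEmb (M 1 0) * y + baseEmb (M 1 1) ≠ 0 := by
  intro h
  obtain ⟨-, h1, h2⟩ := baseEmb_quadratic_eq_zero (a := 0) (by simpa using h)
  rw [Matrix.det_fin_two, h1, h2] at hM
  simp at hM

theorem isMoebius_mob {M : Matrix (Fin 2) (Fin 2) LineMap} (hM : M.det ≠ 0) :
    IsMoebius ℂ⟮x⟯ y (mob M) := by
  refine ⟨_, baseEmb_mem _, _, baseEmb_mem _, _, baseEmb_mem _, _, baseEmb_mem _, ?_, rfl⟩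
  rw [← map_mul, ← map_mul, ← map_sub, ← Matrix.det_fin_two]
  exact (map_ne_zero _).2 hM

theorem mob_smul {k : LineMap} (hk : k ≠ 0) (M : Matrix (Fin 2) (Fin 2) LineMap) :
    mob (k • M) = mob M := by
  have hk' : baseEmb k ≠ 0 := (map_ne_zero _).2 hk
  simp only [mob, Matrix.smul_apply, smul_eq_mul, map_mul, mul_assoc, ← mul_add]
  exact mul_div_mul_left _ _ hk'

/-- The composition law of semilinear maps; it makes `cocycle θ M k` the fibre matrix of `h ^ k`. -/
theorem pullback_mob {h : dJo} {θ : LineMap →+* LineMap}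
    (hθ : ∀ k, pullback h (baseEmb k) = baseEmb (θ k)) {M N : Matrix (Fin 2) (Fin 2) LineMap}
    (hM : M.det ≠ 0) (hy : pullback h y = mob M) :
    pullback h (mob N) = mob (N.map θ * M) := by
  have hd := mob_denom_ne_zero hM
  have e : pullback h y * (baseEmb (M 1 0) * y + baseEmb (M 1 1)) =
      baseEmb (M 0 0) * y + baseEmb (M 0 1) := by
    rw [hy, mob, div_mul_cancel₀ _ hd]
  simp only [mob, pullback_div, pullback_add, pullback_mul_apply, hθ]
  rw [← mul_div_mul_right _ _ hd]
  simp only [Matrix.mul_apply, Fin.sum_univ_two, Matrix.map_apply, map_add, map_mul]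
  congr 1
  · linear_combination baseEmb (θ (N 0 0)) * e
  · linear_combination baseEmb (θ (N 1 0)) * e

theorem exists_smul_of_mob_eq {M N : Matrix (Fin 2) (Fin 2) LineMap} (hM : M.det ≠ 0)
    (hN : N.det ≠ 0) (h : mob M = mob N) : ∃ k : LineMap, k ≠ 0 ∧ N = k • M := by
  rw [mob, mob, div_eq_div_iff (mob_denom_ne_zero hM) (mob_denom_ne_zero hN)] at h
  obtain ⟨e₁, e₂, e₃⟩ := baseEmb_quadratic_eq_zero
    (a := M 0 0 * N 1 0 - N 0 0 * M 1 0)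
    (b := M 0 0 * N 1 1 + M 0 1 * N 1 0 - N 0 0 * M 1 1 - N 0 1 * M 1 0)
    (c := M 0 1 * N 1 1 - N 0 1 * M 1 1) (by
      simp only [map_sub, map_add, map_mul]
      linear_combination h)
  have hM' := hM
  rw [Matrix.det_fin_two] at hM'
  -- The aim is that `N adj(M)` is scalar: `f₁` and `f₂` are its off-diagonal entries, and `e₂` with
  -- `f₃` equates its diagonal ones.
  have f₁ : M 0 0 * N 0 1 - M 0 1 * N 0 0 = 0 := by
    apply (mul_eq_zero.1 (_ : (M 0 0 * N 0 1 - M 0 1 * N 0 0) *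
      (M 0 0 * M 1 1 - M 0 1 * M 1 0) = 0)).resolve_right hM'
    linear_combination -(M 0 1) ^ 2 * e₁ - (M 0 0) ^ 2 * e₃ + M 0 0 * M 0 1 * e₂
  have f₂ : N 1 0 * M 1 1 - N 1 1 * M 1 0 = 0 := by
    apply (mul_eq_zero.1 (_ : (N 1 0 * M 1 1 - N 1 1 * M 1 0) *
      (M 0 0 * M 1 1 - M 0 1 * M 1 0) = 0)).resolve_right hM'
    linear_combination (M 1 1) ^ 2 * e₁ + (M 1 0) ^ 2 * e₃ - M 1 0 * M 1 1 * e₂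
  have f₃ : N 0 1 * M 1 0 - M 0 1 * N 1 0 = 0 := by
    apply (mul_eq_zero.1 (_ : (N 0 1 * M 1 0 - M 0 1 * N 1 0) *
      (M 0 0 * M 1 1 - M 0 1 * M 1 0) = 0)).resolve_right hM'
    linear_combination M 0 1 * M 1 0 * e₂ - M 0 0 * M 1 0 * e₃ - M 0 1 * M 1 1 * e₁
  set l := N 0 0 * M 1 1 - N 0 1 * M 1 0 with hl
  have hk : N = (l / M.det) • M := by
    ext i j
    rw [Matrix.smul_apply, smul_eq_mul, div_mul_eq_mul_div, eq_div_iff hM, Matrix.det_fin_two, hl]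
    fin_cases i <;> fin_cases j <;> simp only [Fin.zero_eta, Fin.mk_one]
    · linear_combination M 1 0 * f₁
    · linear_combination M 1 1 * f₁
    · linear_combination M 0 0 * f₂ + M 1 0 * e₂ + 2 * M 1 0 * f₃
    · linear_combination M 0 1 * f₂ + M 1 1 * e₂ + 2 * M 1 1 * f₃
  refine ⟨_, ?_, hk⟩
  intro h0
  rw [h0, zero_smul] at hk
  rw [hk] at hN
  simp at hN

theorem pullback_pow_y {h : dJo} {θ : LineMap →+* LineMap}
    (hθ : ∀ k, pullback h (baseEmb k) = baseEmb (θ k)) {M : Matrix (Fin 2) (Fin 2) LineMap}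
    (hM : M.det ≠ 0) (hy : pullback h y = mob M) (k : ℕ) :
    pullback (h ^ k : dJo) y = mob (cocycle θ M k) := by
  induction k with
  | zero => simp [pullback, cocycle, mob]
  | succ k ih => rw [pullback_pow_succ, ih, pullback_mob hθ hM hy]; rfl

theorem IsFibreForm.eq_mob {M : Matrix (Fin 2) (Fin 2) ℂ[X]} {w : FunctionField}
    (h : IsFibreForm M w) (hM : M.det ≠ 0) : w = mob (M.map (algebraMap ℂ[X] LineMap)) := by
  rw [mob, eq_div_iff]
  · simpa only [Matrix.map_apply, baseEmb_algebraMap, IsFibreForm] using h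
  · simpa only [Matrix.map_apply, baseEmb_algebraMap] using fibre_denom_ne_zero hM

theorem det_map_algebraMap_ne_zero {M : Matrix (Fin 2) (Fin 2) ℂ[X]} (hM : M.det ≠ 0) :
    (M.map (algebraMap ℂ[X] LineMap)).det ≠ 0 := by
  rw [← RingHom.mapMatrix_apply, ← RingHom.map_det]
  rwa [Ne, map_eq_zero_iff _ (IsFractionRing.injective ℂ[X] LineMap)]

/-! ### Homographies of the fibres with common fixed points. -/

theorem FixesAt.vieta {M : Matrix (Fin 2) (Fin 2) ℂ[X]} {s t₁ t₂ : ℂ} (h₁ : FixesAt M s t₁)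
    (h₂ : FixesAt M s t₂) (hne : t₁ ≠ t₂) :
    (M 0 0).eval s - (M 1 1).eval s = (M 1 0).eval s * (t₁ + t₂) ∧
      (M 0 1).eval s = -(M 1 0).eval s * (t₁ * t₂) := by
  rw [FixesAt] at h₁ h₂
  have hd : t₁ - t₂ ≠ 0 := sub_ne_zero.2 hne
  have e1 : (M 0 0).eval s - (M 1 1).eval s = (M 1 0).eval s * (t₁ + t₂) := by
    apply mul_left_cancel₀ hd
    linear_combination h₂ - h₁
  refine ⟨e1, ?_⟩
  linear_combination -h₁ - t₁ * e1

/-- Two involutions of the fibres that fix the same two points in infinitely many fibres are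
proportional. -/
theorem traceless_proportional {S T : Matrix (Fin 2) (Fin 2) ℂ[X]} (hS : S.det ≠ 0)
    (hT : T.det ≠ 0) (hSt : S 1 1 = -S 0 0) (hTt : T 1 1 = -T 0 0)
    (h : ∃ᶠ s in cofinite, ∃ t₁ t₂, t₁ ≠ t₂ ∧ FixesAt S s t₁ ∧ FixesAt S s t₂ ∧
      FixesAt T s t₁ ∧ FixesAt T s t₂) :
    ∃ k : LineMap, k ≠ 0 ∧
      T.map (algebraMap ℂ[X] LineMap) = k • S.map (algebraMap ℂ[X] LineMap) := by
  -- By Vieta, a traceless matrix is determined by its lower left entry and its two fixed points.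
  have key : ∀ i j, S 1 0 * T i j = T 1 0 * S i j := by
    intro i j
    rw [← sub_eq_zero]
    apply eval_eq_zero_of_infinite
    refine h.mono fun s hs => ?_
    obtain ⟨t₁, t₂, hne, s1, s2, r1, r2⟩ := hs
    obtain ⟨a1, a2⟩ := s1.vieta s2 hne
    obtain ⟨b1, b2⟩ := r1.vieta r2 hne
    rw [hSt, Polynomial.eval_neg] at a1
    rw [hTt, Polynomial.eval_neg] at b1
    simp only [Polynomial.eval_sub, Polynomial.eval_mul]
    fin_cases i <;> fin_cases j <;>
      simp only [Fin.zero_eta, Fin.mk_one, hSt, hTt, Polynomial.eval_neg]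
    · linear_combination (1 / 2) * (S 1 0).eval s * b1 - (1 / 2) * (T 1 0).eval s * a1
    · linear_combination (S 1 0).eval s * b2 - (T 1 0).eval s * a2
    · ring
    · linear_combination (1 / 2) * (T 1 0).eval s * a1 - (1 / 2) * (S 1 0).eval s * b1
  have h10 : ∀ {R : Matrix (Fin 2) (Fin 2) ℂ[X]}, R.det ≠ 0 → R 1 1 = -R 0 0 →
      (∃ᶠ s in cofinite, ∃ t₁ t₂, t₁ ≠ t₂ ∧ FixesAt R s t₁ ∧ FixesAt R s t₂) → R 1 0 ≠ 0 := by
    intro R hR hRt hf h0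
    obtain ⟨s, ⟨t₁, t₂, hne, s1, s2⟩, hs⟩ := (hf.and_eventually (eventually_eval_ne_zero hR)).exists
    obtain ⟨a1, a2⟩ := s1.vieta s2 hne
    rw [hRt, h0, Polynomial.eval_neg, Polynomial.eval_zero] at a1
    apply hs
    have : (R 0 0).eval s = 0 := by linear_combination (1 / 2) * a1
    simp [Matrix.det_fin_two, hRt, h0, this]
  have hS10 := h10 hS hSt (h.mono fun s ⟨t₁, t₂, a, b, c, _⟩ => ⟨t₁, t₂, a, b, c⟩)
  have hT10 := h10 hT hTt (h.mono fun s ⟨t₁, t₂, a, _, _, b, c⟩ => ⟨t₁, t₂, a, b, c⟩)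
  have hinj := IsFractionRing.injective ℂ[X] LineMap
  have hS' : algebraMap ℂ[X] LineMap (S 1 0) ≠ 0 := by rwa [Ne, map_eq_zero_iff _ hinj]
  have hT' : algebraMap ℂ[X] LineMap (T 1 0) ≠ 0 := by rwa [Ne, map_eq_zero_iff _ hinj]
  refine ⟨algebraMap ℂ[X] LineMap (T 1 0) / algebraMap ℂ[X] LineMap (S 1 0), div_ne_zero hT' hS', ?_⟩
  ext i j
  have := congrArg (algebraMap ℂ[X] LineMap) (key i j)
  rw [map_mul, map_mul] at this
  rw [Matrix.smul_apply, smul_eq_mul, div_mul_eq_mul_div, eq_div_iff hS', mul_comm]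
  exact this

/-- Homographies of the fibres with two common fixed points in infinitely many fibres commute. -/
theorem commute_of_fixesAt {S T : Matrix (Fin 2) (Fin 2) ℂ[X]}
    (h : ∃ᶠ s in cofinite, ∃ t₁ t₂, t₁ ≠ t₂ ∧ FixesAt S s t₁ ∧ FixesAt S s t₂ ∧
      FixesAt T s t₁ ∧ FixesAt T s t₂) : S * T = T * S := by
  rw [← sub_eq_zero]
  ext1 i j
  apply eval_eq_zero_of_infinite
  refine h.mono fun s hs => ?_
  obtain ⟨t₁, t₂, hne, s1, s2, r1, r2⟩ := hs
  -- Vieta writes both matrices as combinations of the identity and the single matrix with rows `(t₁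
  -- + t₂, -t₁ t₂)` and `(1, 0)`.
  obtain ⟨a1, a2⟩ := s1.vieta s2 hne
  obtain ⟨b1, b2⟩ := r1.vieta r2 hne
  fin_cases i <;> fin_cases j <;>
    simp only [Fin.zero_eta, Fin.mk_one, Matrix.sub_apply, Matrix.mul_apply, Fin.sum_univ_two,
      Polynomial.eval_sub, Polynomial.eval_add, Polynomial.eval_mul]
  · linear_combination (T 1 0).eval s * a2 - (S 1 0).eval s * b2
  · linear_combination (T 0 1).eval s * a1 - (S 0 1).eval s * b1 +
      (S 1 0).eval s * (t₁ + t₂) * b2 - (T 1 0).eval s * (t₁ + t₂) * a2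
  · linear_combination (S 1 0).eval s * b1 - (T 1 0).eval s * a1
  · linear_combination (S 1 0).eval s * b2 - (T 1 0).eval s * a2

/-- If `M` and `N` send `t` to the same point, then `N⁻¹ M` fixes `t`; the adjugate stands in for
the inverse over `ℂ[X]`. -/
theorem fixesAt_adjugate_mul {M N : Matrix (Fin 2) (Fin 2) ℂ[X]} {s t r : ℂ}
    (h₁ : r * ((M 1 0).eval s * t + (M 1 1).eval s) = (M 0 0).eval s * t + (M 0 1).eval s)
    (h₂ : r * ((N 1 0).eval s * t + (N 1 1).eval s) = (N 0 0).eval s * t + (N 0 1).eval s) :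
    FixesAt (N.adjugate * M) s t := by
  simp only [FixesAt, Matrix.adjugate_fin_two, Matrix.mul_apply, Fin.sum_univ_two, Matrix.of_apply,
    Matrix.cons_val', Matrix.cons_val_zero, Matrix.cons_val_one, Matrix.cons_val_fin_one,
    Polynomial.eval_add, Polynomial.eval_mul, Polynomial.eval_neg]
  linear_combination ((N 1 0).eval s * t + (N 1 1).eval s) * h₁ -
    ((M 1 0).eval s * t + (M 1 1).eval s) * h₂

/-! ### Conjugacy over a common base action. -/

/-- Two elements with the same action `x ↦ ζ x` on the base, whose `n`-th powers are involutions,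
and which agree at two fixed points of these involutions in infinitely many fibres, are
conjugate. -/
theorem isConj_of_agree {n : ℕ} (hn : 0 < n) {h₁ h₂ : dJo} {ζ : ℂ} (hζ : IsPrimitiveRoot ζ n)
    (hx₁ : pullback h₁ x = algebraMap ℂ FunctionField ζ * x)
    (hx₂ : pullback h₂ x = algebraMap ℂ FunctionField ζ * x)
    (hsq₁ : h₁ ^ n * h₁ ^ n = 1) (hsq₂ : h₂ ^ n * h₂ ^ n = 1) (hne₁ : h₁ ^ n ≠ 1) (hne₂ : h₂ ^ n ≠ 1)
    (h : ∃ᶠ s in cofinite, ∃ t₁ t₂, t₁ ≠ t₂ ∧ ∀ t, t = t₁ ∨ t = t₂ →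
      SendsPt (h₁ ^ n) (s, t) (s, t) ∧ SendsPt (h₂ ^ n) (s, t) (s, t) ∧
        ∃ r, SendsPt h₁ (s, t) r ∧ SendsPt h₂ (s, t) r) : IsConj h₁ h₂ := by
  have hbase : ∀ {g : dJo}, pullback g x = algebraMap ℂ FunctionField ζ * x →
      pullback (g ^ n : dJo) x = x := by
    intro g hg
    rw [pullback_pow_linear hg, hζ.pow_eq_one, map_one, one_mul]
  obtain ⟨S₁, hS₁, hSt₁, hf₁⟩ := exists_traceless_form (hbase hx₁) hsq₁ hne₁
  obtain ⟨S₂, hS₂, hSt₂, hf₂⟩ := exists_traceless_form (hbase hx₂) hsq₂ hne₂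
  obtain ⟨M₁, hM₁, hg₁⟩ := exists_isFibreForm h₁.2.2
  obtain ⟨M₂, hM₂, hg₂⟩ := exists_isFibreForm h₂.2.2
  obtain ⟨k₀, hk₀, hS⟩ := traceless_proportional hS₁ hS₂ hSt₁ hSt₂ (h.mono fun s hs => by
    obtain ⟨t₁, t₂, hne, ht⟩ := hs
    obtain ⟨a₁, a₂, -⟩ := ht t₁ (Or.inl rfl)
    obtain ⟨b₁, b₂, -⟩ := ht t₂ (Or.inr rfl)
    exact ⟨t₁, t₂, hne, hf₁.eval_eq a₁.2, hf₁.eval_eq b₁.2, hf₂.eval_eq a₂.2, hf₂.eval_eq b₂.2⟩)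
  have hcomm : M₂.adjugate * M₁ * S₁ = S₁ * (M₂.adjugate * M₁) :=
    commute_of_fixesAt (h.mono fun s hs => by
      obtain ⟨t₁, t₂, hne, ht⟩ := hs
      obtain ⟨a₁, -, r, c₁, c₂⟩ := ht t₁ (Or.inl rfl)
      obtain ⟨b₁, -, q, d₁, d₂⟩ := ht t₂ (Or.inr rfl)
      exact ⟨t₁, t₂, hne, fixesAt_adjugate_mul (hg₁.eval_eq c₁.2) (hg₂.eval_eq c₂.2),
        fixesAt_adjugate_mul (hg₁.eval_eq d₁.2) (hg₂.eval_eq d₂.2), hf₁.eval_eq a₁.2,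
        hf₁.eval_eq b₁.2⟩)
  obtain ⟨θ, hθ⟩ := exists_scaling (hζ.ne_zero hn.ne')
  have hθn : θ ^ n = 1 := hθ.pow_eq_one hζ.pow_eq_one
  have hθ₁ := pullback_baseEmb hx₁ hθ
  have hθ₂ := pullback_baseEmb hx₂ hθ
  set N₁ := M₁.map (algebraMap ℂ[X] LineMap) with hN₁
  set N₂ := M₂.map (algebraMap ℂ[X] LineMap) with hN₂
  set T₁ := S₁.map (algebraMap ℂ[X] LineMap) with hT₁
  have dN₁ : N₁.det ≠ 0 := det_map_algebraMap_ne_zero hM₁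
  have dN₂ : N₂.det ≠ 0 := det_map_algebraMap_ne_zero hM₂
  have y₁ : pullback h₁ y = mob N₁ := hg₁.eq_mob hM₁
  have y₂ : pullback h₂ y = mob N₂ := hg₂.eq_mob hM₂
  -- The involution `h₁ ^ n` has both `S₁` and the `n`-th cocycle of `N₁` as fibre matrix, so these
  -- are proportional; likewise for `h₂`.
  obtain ⟨k₁, hk₁, e₁⟩ := exists_smul_of_mob_eq (det_map_algebraMap_ne_zero hS₁)
    (det_cocycle_ne_zero dN₁ n) ((hf₁.eq_mob hS₁).symm.trans (pullback_pow_y hθ₁ dN₁ y₁ n))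
  obtain ⟨k₂, hk₂, e₂⟩ := exists_smul_of_mob_eq (det_map_algebraMap_ne_zero hS₂)
    (det_cocycle_ne_zero dN₂ n) ((hf₂.eq_mob hS₂).symm.trans (pullback_pow_y hθ₂ dN₂ y₂ n))
  rw [hS] at e₂
  set A := cocycle θ N₁ n with hA
  set k := k₂ * k₀ / k₁ with hk
  have hk0 : k ≠ 0 := div_ne_zero (mul_ne_zero hk₂ hk₀) hk₁
  have e₃ : cocycle θ N₂ n = k • A := by
    rw [e₂, e₁, smul_smul, smul_smul, hk, div_mul_cancel₀ _ hk₁]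
  have hDA : N₂.adjugate * N₁ * A = A * (N₂.adjugate * N₁) := by
    have := congrArg (fun M => M.map (algebraMap ℂ[X] LineMap)) hcomm
    simp only [Matrix.map_mul] at this
    rw [e₁, mul_smul_comm, smul_mul_assoc]
    congr 1
    have hadj : N₂.adjugate = M₂.adjugate.map (algebraMap ℂ[X] LineMap) :=
      ((algebraMap ℂ[X] LineMap).map_adjugate M₂).symm
    rw [hadj]
    exact this
  have hcyc : ∀ N, (cocycle θ N n).map θ * N = N * cocycle θ N n := by
    intro N
    have := cocycle_succ' (θ := θ) N n
    rw [hθn] at this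
    exact this
  -- Compare `A^θ N₁ = N₁ A` with `θ(k) A^θ N₂ = k N₂ A`, after multiplying the latter on the right
  -- by `adj(N₂) N₁`, which commutes with `A`.
  have hθk : θ k = k := by
    have c₁ := hcyc N₁
    have c₂ := hcyc N₂
    rw [← hA] at c₁
    rw [e₃] at c₂
    have c₃ : (k • A).map θ = θ k • A.map θ := by
      ext i j
      simp
    rw [c₃, smul_mul_assoc, mul_smul_comm] at c₂
    have c₄ := congrArg (fun M => M * (N₂.adjugate * N₁)) c₂
    simp only [smul_mul_assoc] at c₄
    rw [mul_assoc, mul_assoc, ← hDA, ← mul_assoc N₂, ← mul_assoc N₂, ← mul_assoc N₂,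
      Matrix.mul_adjugate, smul_mul_assoc, smul_mul_assoc, one_mul, mul_smul_comm, c₁, smul_smul,
      smul_smul] at c₄
    have hne : N₁ * A ≠ 0 := by
      intro h0
      have := congrArg Matrix.det h0
      rw [Matrix.det_mul, Matrix.det_zero] at this
      exact mul_ne_zero dN₁ (det_cocycle_ne_zero dN₁ n) this
    exact mul_right_cancel₀ dN₂ (smul_left_injective _ hne c₄)
  obtain ⟨m, hm, hmk⟩ := exists_cyclicNorm_eq hθ hn hζ hθk hk0
  -- Scaling by `m⁻¹` leaves the homography unchanged and divides the `n`-th cocycle of `N₂` by the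
  -- norm `k` of `m`.
  have dN₂' : (m⁻¹ • N₂).det ≠ 0 := by
    rw [Matrix.det_smul]
    exact mul_ne_zero (pow_ne_zero _ (inv_ne_zero hm)) dN₂
  have hcoc : cocycle θ N₁ n = cocycle θ (m⁻¹ • N₂) n := by
    rw [cocycle_smul, e₃, ← hA]
    simp only [map_inv₀, Finset.prod_inv_distrib, hmk]
    rw [smul_smul, inv_mul_cancel₀ hk0, one_smul]
  obtain ⟨P, hP, hPN⟩ := exists_intertwiner hθn dN₁ dN₂' hcoc (Finset.range n)
    (fun j => algebraMap ℂ[X] LineMap Polynomial.X ^ j)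
    (fun j => (algebraMap ℂ[X] LineMap Polynomial.X ^ j)⁻¹) (Nat.cast_ne_zero.2 hn.ne')
    (fun i hi => hθ.independent hζ hi) hn
  obtain ⟨ρ, hρx, hρy⟩ := exists_dJo (IsMoebius.refl _ x) (isMoebius_mob hP)
  have hρb : ∀ k, pullback ρ (baseEmb k) = baseEmb ((RingHom.id LineMap) k) := by
    refine pullback_baseEmb (ζ := 1) (by rw [hρx, map_one, one_mul]) fun p => ?_
    simp
  have hconj : ρ * h₂ = h₁ * ρ := by
    apply dJo_ext
    · rw [Subgroup.coe_mul, Subgroup.coe_mul, pullback_mul, pullback_mul, hρx, hx₁, hx₂,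
        pullback_mul_apply, pullback_algebraMap, hρx]
    · rw [Subgroup.coe_mul, Subgroup.coe_mul, pullback_mul, pullback_mul, hρy, y₁,
        pullback_mob hθ₂ dN₂ y₂, pullback_mob hρb hP hρy]
      have e4 : N₁.map (RingHom.id LineMap) = N₁ := by ext i j; simp
      rw [e4, ← hPN, mul_smul_comm, mob_smul (inv_ne_zero hm)]
  rw [isConj_iff]
  refine ⟨ρ⁻¹, ?_⟩
  rw [inv_inv, mul_assoc, ← hconj, inv_mul_cancel_left]

/-! ### Extending a birational map of curves to the plane. -/

theorem PlaneMap.Sends.unique {ψ : PlaneMap} {p q r : ℂ × ℂ} (h : ψ.Sends p q)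
    (h' : ψ.Sends p r) : q = r :=
  Prod.ext (HasValue.unique h.1 h'.1) (HasValue.unique h.2 h'.2)

/-- On the fixed curve of a homography of the fibres, polynomials are linear in `y`. -/
theorem exists_linear_reduction {S : Matrix (Fin 2) (Fin 2) ℂ[X]} (hS : S 1 0 ≠ 0) (P : ℂ[X][Y]) :
    ∃ e a b : ℂ[X], e ≠ 0 ∧ ∀ s t, FixesAt S s t →
      e.eval s * P.evalEval s t = a.eval s * t + b.eval s := by
  induction P using Polynomial.induction_on with
  | C a => exact ⟨1, 0, a, one_ne_zero, fun s t _ => by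
      rw [Polynomial.evalEval_C]; simp⟩
  | add P Q hP hQ =>
    obtain ⟨e, a, b, he, h⟩ := hP
    obtain ⟨e', a', b', he', h'⟩ := hQ
    refine ⟨e * e', e' * a + e * a', e' * b + e * b', mul_ne_zero he he', fun s t hst => ?_⟩
    simp only [Polynomial.evalEval_add, Polynomial.eval_mul, Polynomial.eval_add]
    linear_combination e'.eval s * h s t hst + e.eval s * h' s t hst
  | monomial n c hn =>
    obtain ⟨e, a, b, he, h⟩ := hn
    -- Multiplication by `t` produces `t²`, removed through `S₁₀ t² = (S₀₀ - S₁₁) t + S₀₁`.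
    refine ⟨S 1 0 * e, a * (S 0 0 - S 1 1) + b * S 1 0, a * S 0 1, mul_ne_zero hS he,
      fun s t hst => ?_⟩
    have h1 := h s t hst
    rw [FixesAt] at hst
    rw [pow_succ, ← mul_assoc, Polynomial.evalEval_mul, Polynomial.evalEval_X]
    simp only [Polynomial.eval_mul, Polynomial.eval_add, Polynomial.eval_sub]
    linear_combination (S 1 0).eval s * t * h1 + a.eval s * hst

theorem IsFibreForm.valueAt_of_eq {M : Matrix (Fin 2) (Fin 2) ℂ[X]} {w : FunctionField} {p : ℂ × ℂ}
    {t : ℂ} (h : IsFibreForm M w) (hne : (M 1 0).eval p.1 * p.2 + (M 1 1).eval p.1 ≠ 0)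
    (ht : t * ((M 1 0).eval p.1 * p.2 + (M 1 1).eval p.1) =
      (M 0 0).eval p.1 * p.2 + (M 0 1).eval p.1) : ValueAt p w t := by
  rw [eq_div_of_mul_eq hne ht]
  exact h.valueAt hne

theorem IsBaseForm.valueAt_of_eq {A : Matrix (Fin 2) (Fin 2) ℂ} {u : FunctionField} {p : ℂ × ℂ}
    {s : ℂ} (h : IsBaseForm A u) (hne : A 1 0 * p.1 + A 1 1 ≠ 0)
    (hs : s * (A 1 0 * p.1 + A 1 1) = A 0 0 * p.1 + A 0 1) : ValueAt p u s := by
  rw [eq_div_of_mul_eq hne hs]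
  exact h.valueAt hne

theorem ofPoly_lin_ne_zero {A : Matrix (Fin 2) (Fin 2) ℂ} (hA : A.det ≠ 0) :
    ofPoly (lin (A 1 0) (A 1 1)) ≠ 0 := by
  rw [Ne, ofPoly_eq_zero]
  intro h
  apply hA
  have h0 := congrArg (fun p => Polynomial.coeff p 0) h
  have h1 := congrArg (fun p => Polynomial.coeff p 1) h
  simp [lin] at h0 h1
  simp [Matrix.det_fin_two, h0, h1]

theorem exists_dJo_of_forms {A : Matrix (Fin 2) (Fin 2) ℂ} {M : Matrix (Fin 2) (Fin 2) ℂ[X]}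
    (hA : A.det ≠ 0) (hM : M.det ≠ 0) :
    ∃ g : dJo, IsBaseForm A (pullback g x) ∧ IsFibreForm M (pullback g y) := by
  obtain ⟨g, hx, hy⟩ := exists_dJo
    (u := ofPoly (lin (A 0 0) (A 0 1)) / ofPoly (lin (A 1 0) (A 1 1)))
    (w := (ofPoly (M 0 0) * y + ofPoly (M 0 1)) / (ofPoly (M 1 0) * y + ofPoly (M 1 1)))
    (by
      refine ⟨_, algebraMap_mem_bot (A 0 0), _, algebraMap_mem_bot (A 0 1), _,
        algebraMap_mem_bot (A 1 0), _, algebraMap_mem_bot (A 1 1), ?_, ?_⟩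
      · rw [← map_mul, ← map_mul, ← map_sub, ← Matrix.det_fin_two]
        exact (map_ne_zero _).2 hA
      · rw [ofPoly_lin, ofPoly_lin])
    (by
      refine ⟨_, ofPoly_mem _, _, ofPoly_mem _, _, ofPoly_mem _, _, ofPoly_mem _, ?_, rfl⟩
      rw [← map_mul, ← map_mul, ← map_sub, ← Matrix.det_fin_two, Ne, ofPoly_eq_zero]
      exact hM)
  refine ⟨g, ?_, ?_⟩
  · rw [hx]
    exact div_mul_cancel₀ _ (ofPoly_lin_ne_zero hA)
  · rw [hy]
    exact div_mul_cancel₀ _ (fibre_denom_ne_zero hM)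

/-- A birational map between curves that are general two-to-one covers of the base, compatible with
a birational map of the base, is induced by an element of the de Jonquières group. -/
theorem exists_extension {σ₁ : dJo} {S₁ : Matrix (Fin 2) (Fin 2) ℂ[X]} {Γ₁ Γ₂ : Set (ℂ × ℂ)}
    (hΓ₁ : IsFixedLocus σ₁ S₁ Γ₁) {ψ : PlaneMap} {α : LineMap} (hψ : ψ.IsBirational Γ₁ Γ₂)
    (hα : α.IsBirational) (hcov : Covers ψ α Γ₁) :
    ∃ g : dJo, ∀ᶠ s in cofinite, ∀ t, (s, t) ∈ Γ₁ → ∀ q, ψ.Sends (s, t) q → SendsPt g (s, t) q := by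
  obtain ⟨A, hA, hAα⟩ := hα.exists_homography
  obtain ⟨P, Q, -, -, hPQ, hQ⟩ := exists_reduced ℂ[X][Y] ψ.2
  have hS10 : S₁ 1 0 ≠ 0 := by
    obtain ⟨s, hs, -⟩ := hΓ₁.generic.exists
    rintro h0
    simp [h0] at hs
  obtain ⟨e, a, b, he, hP⟩ := exists_linear_reduction hS10 P
  obtain ⟨e', a', b', he', hQ'⟩ := exists_linear_reduction hS10 Q
  obtain ⟨φ, hφ, -⟩ := hψ
  have hfib : ∀ᶠ s in cofinite, ∀ t, (s, t) ∈ Γ₁ → ∀ q, ψ.Sends (s, t) q →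
      e.eval s * (a'.eval s * t + b'.eval s) ≠ 0 ∧
      q.2 * (e.eval s * (a'.eval s * t + b'.eval s)) =
        e'.eval s * (a.eval s * t + b.eval s) := by
    filter_upwards [hΓ₁.generic, eventually_eval_ne_zero he, eventually_eval_ne_zero he']
      with s hs h1 h2 t ht q hq
    have hfx := (hs.2.1 t).1 ht
    have h3 : Q.evalEval s t ≠ 0 := hQ _ _ hq.2
    have h4 : P.evalEval s t = q.2 * Q.evalEval s t := hq.2.eval_eq hPQ
    rw [← hP s t hfx, ← hQ' s t hfx]
    refine ⟨mul_ne_zero h1 (mul_ne_zero h2 h3), ?_⟩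
    rw [h4]
    ring
  set M : Matrix (Fin 2) (Fin 2) ℂ[X] := !![e' * a, e' * b; e * a', e * b'] with hM
  -- A degenerate `M` would send two points of a general fibre of `Γ₁` to the same point, whereas
  -- `ψ` is invertible on `Γ₁`.
  have hMdet : M.det ≠ 0 := by
    intro h0
    obtain ⟨s, h1, h2, h3, h4⟩ := (hfib.and ((Generically.eventually hφ).and
      ((Generically.eventually hcov).and hΓ₁.generic))).exists
    obtain ⟨-, -, t₁, t₂, hne, m₁, m₂⟩ := h4
    obtain ⟨q₁, -, c₁, d₁⟩ := h2 t₁ m₁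
    obtain ⟨q₂, -, c₂, d₂⟩ := h2 t₂ m₂
    obtain ⟨r₁, k₁, l₁⟩ := h3 t₁ m₁
    obtain ⟨r₂, k₂, l₂⟩ := h3 t₂ m₂
    rw [k₁.unique c₁] at l₁
    rw [k₂.unique c₂] at l₂
    obtain ⟨n₁, f₁⟩ := h1 t₁ m₁ q₁ c₁
    obtain ⟨n₂, f₂⟩ := h1 t₂ m₂ q₂ c₂
    have hd := congrArg (Polynomial.eval s) h0
    rw [hM, Matrix.det_fin_two_of] at hd
    simp only [Polynomial.eval_sub, Polynomial.eval_mul, Polynomial.eval_zero] at hd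
    have hq : q₁ = q₂ := by
      refine Prod.ext (HasValue.unique l₁ l₂) ?_
      apply mul_right_cancel₀ (mul_ne_zero n₁ n₂)
      linear_combination (e.eval s * (a'.eval s * t₂ + b'.eval s)) * f₁ -
        (e.eval s * (a'.eval s * t₁ + b'.eval s)) * f₂ + (t₁ - t₂) * hd
    rw [hq] at d₁
    exact hne (congrArg Prod.snd (d₁.unique d₂))
  obtain ⟨g, hgA, hgM⟩ := exists_dJo_of_forms hA hMdet
  refine ⟨g, ?_⟩
  filter_upwards [hfib, eventually_moebius hA (P := fun _ => True) (by simp),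
    Generically.eventually hcov] with s h1 h2 h3 t ht q hq
  obtain ⟨n, f⟩ := h1 t ht q hq
  obtain ⟨r, k, l⟩ := h3 t ht
  rw [k.unique hq] at l
  have hA' := hAα _ _ l
  refine ⟨hgA.valueAt_of_eq h2.1 hA', hgM.valueAt_of_eq ?_ ?_⟩
  · simp only [hM, Matrix.of_apply, Matrix.cons_val', Matrix.cons_val_zero, Matrix.cons_val_one,
      Matrix.cons_val_fin_one, Polynomial.eval_mul]
    intro h0
    apply n
    linear_combination h0
  · simp only [hM, Matrix.of_apply, Matrix.cons_val', Matrix.cons_val_zero, Matrix.cons_val_one,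
      Matrix.cons_val_fin_one, Polynomial.eval_mul]
    linear_combination f

theorem pullback_inv_apply (g : dJo) (f : FunctionField) :
    pullback (g⁻¹ : dJo) (pullback g f) = f := (g : Bir).unop.symm_apply_apply f

/-! ### From conjugate restrictions to conjugate elements. -/

/-- Elements with conjugate restrictions to their fixed curves are conjugate. -/
theorem isConj_of_conjugatesRestrictions {n : ℕ} {h₁ h₂ : dJo} (hord₁ : orderOf h₁ = 2 * n)
    (hord₂ : orderOf h₂ = 2 * n) (hbase₂ : HasBaseOrder h₂ n)
    {S₁ S₂ : Matrix (Fin 2) (Fin 2) ℂ[X]} {Γ₁ Γ₂ : Set (ℂ × ℂ)}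
    (hΓ₁ : IsFixedLocus (h₁ ^ n) S₁ Γ₁) (hΓ₂ : IsFixedLocus (h₂ ^ n) S₂ Γ₂)
    {ψ : PlaneMap} {α : LineMap} (hψ : ψ.IsBirational Γ₁ Γ₂) (hα : α.IsBirational)
    (hcov : Covers ψ α Γ₁) (hconj : ConjugatesRestrictions ψ h₁ h₂ Γ₁ Γ₂) : IsConj h₁ h₂ := by
  obtain ⟨g, hg⟩ := exists_extension hΓ₁ hψ hα hcov
  obtain ⟨u, ζ, hu, hζ, huζ⟩ := exists_eigencoordinate hbase₂
  obtain ⟨b, hbx, hby⟩ := exists_dJo hu (IsMoebius.refl _ y)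
  obtain ⟨B, hB, hBu⟩ := exists_isBaseForm hu
  have hb : ∀ᶠ s in cofinite, ∀ t, SendsPt b (s, t)
      ((B 0 0 * s + B 0 1) / (B 1 0 * s + B 1 1), t) := by
    filter_upwards [eventually_moebius hB (P := fun _ => True) (by simp)] with s hs t
    refine ⟨?_, ?_⟩
    · rw [toPlaneMap, hbx]
      exact hBu.valueAt (p := (s, t)) hs.1
    · rw [toPlaneMap, hby]
      exact valueAt_y _
  -- `b` linearises the base action of `h₂`, and `g` extends `ψ`; so `k₁` and `k₂` should agree on
  -- the image of `Γ₁` under `f`.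
  set f := b * g with hf
  set k₁ := f * h₁ * f⁻¹ with hk₁
  set k₂ := b * h₂ * b⁻¹ with hk₂
  have hk₁n : k₁ ^ n = f * h₁ ^ n * f⁻¹ := conj_pow
  have hk₂n : k₂ ^ n = b * h₂ ^ n * b⁻¹ := conj_pow
  have hn : 0 < n := hbase₂.1
  have hsq : ∀ {h k c : dJo}, orderOf h = 2 * n → k ^ n = c * h ^ n * c⁻¹ → k ^ n * k ^ n = 1 := by
    intro h k c ho hk
    have : h ^ n * h ^ n = 1 := by rw [← pow_add, ← two_mul, ← ho, pow_orderOf_eq_one]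
    rw [hk, conj_mul, this, mul_one, mul_inv_cancel]
  have hne : ∀ {h k c : dJo}, orderOf h = 2 * n → k ^ n = c * h ^ n * c⁻¹ → k ^ n ≠ 1 := by
    intro h k c ho hk h1
    rw [hk, conj_eq_one_iff] at h1
    exact pow_ne_one_of_lt_orderOf hn.ne' (by omega) h1
  have hx₂ : pullback k₂ x = algebraMap ℂ FunctionField ζ * x := by
    rw [hk₂, Subgroup.coe_mul, Subgroup.coe_mul, pullback_mul, pullback_mul, hbx, huζ,
      pullback_mul_apply, pullback_algebraMap, ← hbx, pullback_inv_apply]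
  have hpt : ∀ᶠ s in cofinite, ∀ t, (s, t) ∈ Γ₁ → ∃ q, ψ.Sends (s, t) q ∧
      ∀ r : ℂ × ℂ, r = ((B 0 0 * q.1 + B 0 1) / (B 1 0 * q.1 + B 1 1), q.2) →
        SendsPt f (s, t) r ∧ SendsPt (k₁ ^ n) r r ∧ SendsPt (k₂ ^ n) r r ∧
          ∃ r', SendsPt k₁ r r' ∧ SendsPt k₂ r r' := by
    filter_upwards [hg, eventually_sends h₁ hg, eventually_sends g hb,
      eventually_sends g (eventually_sends h₂ hb), Generically.eventually hconj,
      eventually_sends_inv f, eventually_sends g (eventually_sends_inv b), hΓ₁.fixes,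
      eventually_sends g hΓ₂.fixes] with s e1 e2 e3 e4 e5 e6 e7 e8 e9 t ht
    obtain ⟨p', hp', q, hq, q', hq', c1, c2, c3, c4⟩ := e5 t ht
    refine ⟨q, c3, ?_⟩
    rintro r rfl
    have gq := e1 t ht q c3
    have bq := e3 t q gq q.2
    have fq : SendsPt f (s, t) _ := gq.mul bq
    have fi := e6 t _ fq
    have bi := e7 t q gq q.2 _ bq
    have gq' := e2 t p' c1 p'.2 hp' q' c2
    have bq' := e4 t q gq q.2 q' c4 q'.2
    refine ⟨fq, ?_, ?_, _, fi.mul (SendsPt.mul c1 (gq'.mul bq')),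
      bi.mul (SendsPt.mul c4 bq')⟩
    · rw [hk₁n]
      exact fi.mul ((e8 t ht).mul fq)
    · rw [hk₂n]
      exact bi.mul ((e9 t q gq q.2 hq).mul bq)
  have hagree : ∃ᶠ s in cofinite, ∃ t₁ t₂, t₁ ≠ t₂ ∧ ∀ t, t = t₁ ∨ t = t₂ →
      SendsPt (k₁ ^ n) (s, t) (s, t) ∧ SendsPt (k₂ ^ n) (s, t) (s, t) ∧
        ∃ r, SendsPt k₁ (s, t) r ∧ SendsPt k₂ (s, t) r := by
    -- If agreement failed over almost all base points, it would fail over the image under `f` of a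
    -- general one; yet the two points of `Γ₁` above that point have distinct images in a single
    -- fibre.
    intro hno
    obtain ⟨φ, hφ, -⟩ := hψ
    obtain ⟨s, e1, e2, e3, e4, e5⟩ := (hpt.and ((Generically.eventually hφ).and
      ((Generically.eventually hcov).and (hΓ₁.generic.and (eventually_sends f hno))))).exists
    obtain ⟨-, -, t₁, t₂, hne, m₁, m₂⟩ := e4
    obtain ⟨q₁, a₁, b₁⟩ := e1 t₁ m₁
    obtain ⟨q₂, a₂, b₂⟩ := e1 t₂ m₂
    obtain ⟨r₁, -, c₁, d₁⟩ := e2 t₁ m₁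
    obtain ⟨r₂, -, c₂, d₂⟩ := e2 t₂ m₂
    obtain ⟨z₁, i₁, j₁⟩ := e3 t₁ m₁
    obtain ⟨z₂, i₂, j₂⟩ := e3 t₂ m₂
    rw [c₁.unique a₁] at d₁
    rw [c₂.unique a₂] at d₂
    rw [i₁.unique a₁] at j₁
    rw [i₂.unique a₂] at j₂
    have h1 : q₁.1 = q₂.1 := HasValue.unique j₁ j₂
    have h2 : q₁.2 ≠ q₂.2 := by
      intro h2
      rw [show q₁ = q₂ from Prod.ext h1 h2] at d₁
      exact hne (congrArg Prod.snd (d₁.unique d₂))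
    obtain ⟨f₁, g₁⟩ := b₁ _ rfl
    obtain ⟨-, g₂⟩ := b₂ _ rfl
    refine e5 t₁ _ f₁ ⟨q₁.2, q₂.2, h2, ?_⟩
    rintro t (rfl | rfl)
    · exact g₁
    · rw [h1]
      exact g₂
  -- Agreement with `k₂` over infinitely many base points determines the base homography of `k₁`.
  have hx₁ : pullback k₁ x = algebraMap ℂ FunctionField ζ * x := by
    obtain ⟨C, hC, hCu⟩ := exists_isBaseForm k₁.2.1
    have hpoly : Polynomial.C ζ * Polynomial.X * lin (C 1 0) (C 1 1) - lin (C 0 0) (C 0 1) = 0 := by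
      apply eval_eq_zero_of_infinite
      refine hagree.mono fun s hs => ?_
      obtain ⟨t, _, -, ht⟩ := hs
      obtain ⟨-, -, r, i₁, i₂⟩ := ht t (Or.inl rfl)
      have h1 := hCu.eval_eq i₁.1
      have h2 : ValueAt (s, t) (pullback k₂ x) (ζ * s) := by
        rw [hx₂]
        exact (valueAt_const _ ζ).mul (valueAt_x _)
      rw [HasValue.unique i₂.1 h2] at h1
      simp only [Polynomial.eval_sub, Polynomial.eval_mul, Polynomial.eval_C, Polynomial.eval_X,
        eval_lin]
      linear_combination h1
    have h1 := congrArg ofPoly (sub_eq_zero.1 hpoly)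
    rw [map_mul, map_mul, ofPoly_C, ofPoly_X] at h1
    apply mul_right_cancel₀ (ofPoly_lin_ne_zero hC)
    rw [h1]
    exact hCu
  have hk := isConj_of_agree hn hζ hx₁ hx₂ (hsq hord₁ hk₁n) (hsq hord₂ hk₂n) (hne hord₁ hk₁n)
    (hne hord₂ hk₂n) hagree
  have hh₁ : IsConj h₁ k₁ := isConj_iff.2 ⟨f, rfl⟩
  have hh₂ : IsConj h₂ k₂ := isConj_iff.2 ⟨b, rfl⟩
  exact hh₁.trans (hk.trans hh₂.symm)

end DeJonquieres

end

theorem mainTheorem7 (n : ℕ) (h₁ h₂ : DeJonquieres.dJo)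
    (hord₁ : orderOf h₁ = 2 * n) (hord₂ : orderOf h₂ = 2 * n)
    (hbase₁ : DeJonquieres.HasBaseOrder h₁ n) (hbase₂ : DeJonquieres.HasBaseOrder h₂ n)
    (hdiag₁ : ¬ DeJonquieres.IsDiagonalisable h₁) (hdiag₂ : ¬ DeJonquieres.IsDiagonalisable h₂)
    (Γ₁ Γ₂ : Set (ℂ × ℂ))
    (hcurve₁ : DeJonquieres.IsCurve Γ₁) (hcurve₂ : DeJonquieres.IsCurve Γ₂)
    (hfix₁ : DeJonquieres.FixesCurve (h₁ ^ n) Γ₁) (hfix₂ : DeJonquieres.FixesCurve (h₂ ^ n) Γ₂)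
    (hdeg₁ : DeJonquieres.IsTwoToOne Γ₁) (hdeg₂ : DeJonquieres.IsTwoToOne Γ₂) :
    IsConj h₁ h₂ ↔
      ∃ (ψ : DeJonquieres.PlaneMap) (α : DeJonquieres.LineMap),
        ψ.IsBirational Γ₁ Γ₂ ∧ α.IsBirational ∧ DeJonquieres.Covers ψ α Γ₁ ∧
          DeJonquieres.ConjugatesRestrictions ψ h₁ h₂ Γ₁ Γ₂ := by
  obtain ⟨S₁, hS₁⟩ := DeJonquieres.exists_isFixedLocus hord₁ hbase₁ hcurve₁ hfix₁ hdeg₁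
  obtain ⟨S₂, hS₂⟩ := DeJonquieres.exists_isFixedLocus hord₂ hbase₂ hcurve₂ hfix₂ hdeg₂
  constructor
  · intro h
    obtain ⟨c, hc⟩ := isConj_iff.1 h
    exact DeJonquieres.exists_birational_of_conj hS₁ hS₂ (mul_inv_eq_iff_eq_mul.1 hc)
  · rintro ⟨ψ, α, hψ, hα, hcov, hconj⟩
    exact DeJonquieres.isConj_of_conjugatesRestrictions hord₁ hord₂ hbase₂ hS₁ hS₂ hψ hα hcov hconj
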